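/- Let $q$ be an indeterminate and write $[m]_{q}=1+q+\dots+q^{m-1}$ and $[m]_{q}!=[1]_q[2]_q\cdots[m]_q$. Let $n,x\ge 0$ be integers and let $1\le s_1<s_2<\dots<s_n\le n+x$ be integers. On the triangular lattice (with horizontal lattice lines), consider the right trapezoid whose north, northeast, south and west sides have lengths $x$, $2n-1$, $x+n$, $2n-1$; the north, northeast and south sides follow lattice lines and the west side is a vertical zigzag (starting from the west end of the base with a step to the upper right). The base is adjacent to $n+x$ up-pointing unit triangles, numbered $1,\dots,n+x$ from left to right; remove those at the positions $s_1,\dots,s_n$ (for $n=0$ the region is empty). Use coordinates $(i,j)$ in which the $i$-axis runs along the base, one unit of $i$ is half the length of a lattice edge, one unit of $j$ is the height of a unit triangle, and the $j$-axis is the vertical line through the midpoint of the first (westernmost) unit edge of the base; it passes through the centers of the westernmost possible vertical lozenges along the west side. A lozenge is the union of two unit triangles sharing an edge; it is vertical if the shared edge is horizontal. A vertical lozenge with center $(i,j)$ has weight $\frac{q^{i}+q^{-i}}{2}$ if $i\neq 0$ and weight $\frac12$ if $i=0$; all other lozenges have weight $1$. Denote by $R^3_x(s_1,\dots,s_n)$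 the resulting weighted region, and by $\operatorname{M}(R^3_x(s_1,\dots,s_n))$ its tiling generating function, i.e. the sum over all its lozenge tilings of the product of the weights of the lozenges (the empty region has the single empty tiling, of weight $1$). Then, in $\mathbb{Q}(q)$, $$\begin{aligned} \operatorname{M}(R^{3}_{x}(s_1,\dots,s_n)) &=2^{-n(n-1)}\,q^{-\sum_{i=1}^n\left((4i-4)s_i-2i^2-i+3\right)}\, \frac{\prod_{1\le i<j\le n}[2(s_i+s_j-2)]_{q^2}\,[2(s_j-s_i)]_{q^2}}{\prod_{i=1}^{n}[2i-2]_{q^2}!}\\ &=2^{-n(n-1)}\,q^{-\sum_{i=1}^n\left((4i-4)s_i-2i^2-i+3\right)} \prod_{1\le i<j\le n}\frac{[2(s_i+s_j-2)]_{q^2}}{[i+j-1]_{q^2}} \prod_{1\le i<j\le n}\frac{[2(s_j-s_i)]_{q^2}}{[j-i]_{q^2}} . \end{aligned}$$ -/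

import Mathlib

open Finset

noncomputable section

namespace QuarteredHexagon

/-- A unit triangle of the triangular lattice. Coordinates `(i, j)` of the plane: one unit of `i`
is half the length of a lattice edge, one unit of `j` is the height of a unit triangle, the
`i`-axis is a lattice line, and the `j`-axis bisects horizontal lattice edges on the lines of even
height (in particular the origin is the midpoint of a lattice edge), so that the lattice points are
the integer points `(a, b)` with `a + b` odd.
The pair `(i, j)` stands for the unit triangle in the strip between the lines of height `j` and
`j + 1` whose vertical symmetry axis has abscissa `i`:
* for `i + j` even, the up-pointing triangle with vertices `(i-1, j)`, `(i+1, j)`, `(i, j+1)`;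
* for `i + j` odd, the down-pointing triangle with vertices `(i-1, j+1)`, `(i+1, j+1)`, `(i, j)`. -/
abbrev UnitTriangle : Type := ℤ × ℤ

def IsUp (t : UnitTriangle) : Prop := Even (t.1 + t.2)

/-- A candidate lozenge is a pair (up-pointing triangle, down-pointing triangle). -/
abbrev TrianglePair : Type := UnitTriangle × UnitTriangle

/-- The second triangle lies directly below the first one. If the first one, `(i, j)`, is
up-pointing, the two share the horizontal edge from `(i-1, j)` to `(i+1, j)`, and their union is
the vertical lozenge with center `(i, j)`. -/
def IsVertical (l : TrianglePair) : Prop := l.2 = (l.1.1, l.1.2 - 1)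

/-- The up-pointing triangle `l.1` and the down-pointing triangle `l.2` share an edge: the left,
right or bottom edge of `l.1`. -/
def IsLozenge (l : TrianglePair) : Prop :=
  IsUp l.1 ∧ (l.2 = (l.1.1 - 1, l.1.2) ∨ l.2 = (l.1.1 + 1, l.1.2) ∨ IsVertical l)

/-- `T` is a lozenge tiling of the region `R`: a set of lozenges contained in `R` such that every
unit triangle of `R` belongs to exactly one of them. -/
def IsTiling (R : Finset UnitTriangle) (T : Finset TrianglePair) : Prop :=
  (∀ l ∈ T, IsLozenge l ∧ l.1 ∈ R ∧ l.2 ∈ R) ∧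
    ∀ t ∈ R, ∃! l : TrianglePair, l ∈ T ∧ (l.1 = t ∨ l.2 = t)

open Classical in
/-- The finite set of all lozenge tilings of `R`. -/
def tilings (R : Finset UnitTriangle) : Finset (Finset TrianglePair) :=
  (R ×ˢ R).powerset.filter (IsTiling R)

theorem mem_tilings (R : Finset UnitTriangle) (T : Finset TrianglePair) :
    T ∈ tilings R ↔ IsTiling R T := by
  classical
  simp only [tilings, Finset.mem_filter, Finset.mem_powerset, and_iff_right_iff_imp]
  intro h l hl
  exact Finset.mem_product.2 (h.1 l hl).2

/-- The tiling generating function: the sum over all tilings of the product of the weights of the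
lozenges. -/
def tilingGF {K : Type*} [Field K] (wt : TrianglePair → K) (R : Finset UnitTriangle) : K :=
  ∑ T ∈ tilings R, ∏ l ∈ T, wt l

open Classical in
/-- The weight `wt₂`: a vertical lozenge with center `(i, j)` has weight `(q ^ i + q ^ (-i)) / 2`,
but weight `1 / 2` if it is bisected by the `j`-axis (`i = 0`); other lozenges have weight `1`. -/
def wt₂ {K : Type*} [Field K] (q : K) (l : TrianglePair) : K :=
  if IsVertical l then
    if l.1.1 = 0 then 1 / 2 else (q ^ l.1.1 + q ^ (-l.1.1)) / 2
  else 1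

/-- The right trapezoid with sides `x`, `2n-1`, `x+n`, `2n-1` (north, northeast, south, west), empty
for `n = 0`. It consists of the strips `j = 0, …, 2n-2`. The base runs from `(-1, 0)` to
`(2(x+n)-1, 0)`, the northeast side follows the lattice line from `(2(x+n)-1, 0)` to `(2x, 2n-1)`,
and the west side is the vertical zigzag through `(-1, 0), (0, 1), (-1, 2), …, (0, 2n-1)`: the
leftmost unit triangle of each strip has its symmetry axis on the `j`-axis. -/
def trapezoid (n x : ℕ) : Finset UnitTriangle :=
  (Icc (0 : ℤ) (2 * ((x : ℤ) + n) - 2) ×ˢ Icc (0 : ℤ) (2 * (n : ℤ) - 2)).filter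
    fun t => t.1 + t.2 ≤ 2 * ((x : ℤ) + n) - 2

/-- The `p`-th up-pointing unit triangle on the base, counted from the left, starting with `1`. -/
def baseTriangle (p : ℕ) : UnitTriangle := (2 * (p : ℤ) - 2, 0)

/-- The quartered hexagon: the trapezoid with the up-pointing unit triangles at the positions
`s 1, …, s n` of the base removed. -/
def quarteredHexagon (n x : ℕ) (s : ℕ → ℕ) : Finset UnitTriangle :=
  trapezoid n x \ (Icc 1 n).image fun i => baseTriangle (s i)

/-- The tiling generating function of the weighted region `R³_x(s 1, …, s n)`. -/
def tilingGFR3 {K : Type*} [Field K] (q : K) (n x : ℕ) (s : ℕ → ℕ) : K :=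
  tilingGF (wt₂ q) (quarteredHexagon n x s)

/-- The `q`-integer `[m]_q = 1 + q + ⋯ + q ^ (m - 1)`. -/
def qInt {K : Type*} [Field K] (q : K) (m : ℕ) : K := ∑ k ∈ range m, q ^ k

/-- The `q`-factorial `[m]_q! = [1]_q [2]_q ⋯ [m]_q`. -/
def qFactorial {K : Type*} [Field K] (q : K) (m : ℕ) : K := ∏ k ∈ Icc 1 m, qInt q k

end QuarteredHexagon

end

noncomputable section

namespace QuarteredHexagon

/-! Cut the trapezoid into horizontal strips. Given the up-pointing triangles already removed from a
strip, its tiling is determined by the vertical lozenges crossing its upper line, and their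
abscissas can be any choice of one in each gap between consecutive holes. When the strip starts with
a down-pointing triangle, the stretch before the first hole also counts as a gap
(`tilingGF_strip_down`); otherwise it does not, and one hole is lost (`tilingGF_strip_up`). The
generating function is thus an iterated sum over interlacing sequences.

This sum keeps a product form. With the holes at abscissas `s i`, the part above a line of even
height contributes a constant times the Vandermonde determinant in `qCosh q (2 * s i)`; at odd
height there is an extra factor `∏ qSinh q (s i)`. To pass through a strip (`sum_gap_down`,
`sum_gap_up`), rewrite the Vandermonde determinant in monic polynomials of Chebyshev type, so that
the lozenge weights turn row `i` into values of `qCosh` or `qSinh` at multiples of one abscissa. By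
multilinearity the sum moves into the rows, where it telescopes, and row operations give a
determinant of the same kind in the lower abscissas.

Two strips cost `transferFactor`. Induction (`tilingGF_upperRegion_even`) reaches the base, and
`prod_transferFactor_mul_det` converts the constants and the factors of the Vandermonde determinant
into `q`-integers. -/

/-! ### Tilings and the removal of one lozenge -/

theorem IsTiling.eq_of_mem {R : Finset UnitTriangle} {T : Finset TrianglePair} (h : IsTiling R T)
    {l l' : TrianglePair} (hl : l ∈ T) (hl' : l' ∈ T) {t : UnitTriangle}
    (ht : l.1 = t ∨ l.2 = t) (ht' : l'.1 = t ∨ l'.2 = t) : l = l' := by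
  have htR : t ∈ R := by
    rcases ht with rfl | rfl
    · exact (h.1 l hl).2.1
    · exact (h.1 l hl).2.2
  exact (h.2 t htR).unique ⟨hl, ht⟩ ⟨hl', ht'⟩

theorem IsTiling.erase {R : Finset UnitTriangle} {T : Finset TrianglePair} (h : IsTiling R T)
    {l : TrianglePair} (hl : l ∈ T) : IsTiling (R \ {l.1, l.2}) (T.erase l) := by
  constructor
  · intro m hm
    obtain ⟨hne, hmT⟩ := Finset.mem_erase.1 hm
    obtain ⟨h1, h2, h3⟩ := h.1 m hmT
    refine ⟨h1, ?_, ?_⟩ <;> simp only [mem_sdiff, mem_insert, mem_singleton, not_or]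
    · refine ⟨h2, ?_, ?_⟩ <;> intro e <;> apply hne
      · exact h.eq_of_mem hmT hl (t := m.1) (Or.inl rfl) (Or.inl e.symm)
      · exact h.eq_of_mem hmT hl (t := m.1) (Or.inl rfl) (Or.inr e.symm)
    · refine ⟨h3, ?_, ?_⟩ <;> intro e <;> apply hne
      · exact h.eq_of_mem hmT hl (t := m.2) (Or.inr rfl) (Or.inl e.symm)
      · exact h.eq_of_mem hmT hl (t := m.2) (Or.inr rfl) (Or.inr e.symm)
  · intro t ht
    simp only [mem_sdiff, mem_insert, mem_singleton, not_or] at ht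
    obtain ⟨htR, h1, h2⟩ := ht
    obtain ⟨m, ⟨hmT, hmt⟩, hu⟩ := h.2 t htR
    refine ⟨m, ⟨Finset.mem_erase.2 ⟨?_, hmT⟩, hmt⟩, ?_⟩
    · rintro rfl
      rcases hmt with e | e
      · exact h1 e.symm
      · exact h2 e.symm
    · rintro m' ⟨hm', hm't⟩
      exact hu m' ⟨Finset.mem_of_mem_erase hm', hm't⟩

/-- Inverse to `IsTiling.erase`; the freshness of `l` lets its weight split off from the product. -/
theorem IsTiling.insert {R : Finset UnitTriangle} {T : Finset TrianglePair} {l : TrianglePair}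
    (hl : IsLozenge l) (h1 : l.1 ∈ R) (h2 : l.2 ∈ R) (h : IsTiling (R \ {l.1, l.2}) T) :
    l ∉ T ∧ IsTiling R (insert l T) := by
  have hmem : ∀ m ∈ T, ∀ t, (m.1 = t ∨ m.2 = t) → t ≠ l.1 ∧ t ≠ l.2 := by
    intro m hm t ht
    obtain ⟨_, hm1, hm2⟩ := h.1 m hm
    simp only [mem_sdiff, mem_insert, mem_singleton, not_or] at hm1 hm2
    rcases ht with rfl | rfl
    · exact hm1.2
    · exact hm2.2
  refine ⟨fun hlT => (hmem l hlT l.1 (Or.inl rfl)).1 rfl, ?_, ?_⟩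
  · intro m hm
    rcases Finset.mem_insert.1 hm with rfl | hm
    · exact ⟨hl, h1, h2⟩
    · obtain ⟨h3, h4, h5⟩ := h.1 m hm
      exact ⟨h3, (mem_sdiff.1 h4).1, (mem_sdiff.1 h5).1⟩
  · intro t ht
    by_cases htl : l.1 = t ∨ l.2 = t
    · refine ⟨l, ⟨Finset.mem_insert_self _ _, htl⟩, ?_⟩
      rintro m ⟨hm, hmt⟩
      rcases Finset.mem_insert.1 hm with rfl | hm
      · rfl
      · obtain ⟨n1, n2⟩ := hmem m hm t hmt
        rcases htl with e | e
        · exact absurd e.symm n1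
        · exact absurd e.symm n2
    · have ht' : t ∈ R \ {l.1, l.2} := by
        simp only [mem_sdiff, mem_insert, mem_singleton, not_or]
        exact ⟨ht, fun e => htl (Or.inl e.symm), fun e => htl (Or.inr e.symm)⟩
      obtain ⟨m, ⟨hm, hmt⟩, hu⟩ := h.2 t ht'
      refine ⟨m, ⟨Finset.mem_insert_of_mem hm, hmt⟩, ?_⟩
      rintro m' ⟨hm', hmt'⟩
      rcases Finset.mem_insert.1 hm' with rfl | hm'
      · exact absurd hmt' htl
      · exact hu m' ⟨hm', hmt'⟩

open Classical in
/-- The lozenges contained in `R` that cover the unit triangle `t`. -/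
def lozengesAt (R : Finset UnitTriangle) (t : UnitTriangle) : Finset TrianglePair :=
  (R ×ˢ R).filter fun l => IsLozenge l ∧ (l.1 = t ∨ l.2 = t)

theorem mem_lozengesAt {R : Finset UnitTriangle} {t : UnitTriangle} {l : TrianglePair} :
    l ∈ lozengesAt R t ↔ (l.1 ∈ R ∧ l.2 ∈ R) ∧ IsLozenge l ∧ (l.1 = t ∨ l.2 = t) := by
  classical rw [lozengesAt, mem_filter, Finset.mem_product]

/-- Expansion of the tiling generating function along the lozenge that covers a given unit
triangle. -/
theorem tilingGF_expand {K : Type*} [Field K] (wt : TrianglePair → K) (R : Finset UnitTriangle)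
    {t : UnitTriangle} (ht : t ∈ R) :
    tilingGF wt R = ∑ l ∈ lozengesAt R t, wt l * tilingGF wt (R \ {l.1, l.2}) := by
  classical
  simp only [tilingGF, Finset.mul_sum]
  rw [Finset.sum_sigma']
  symm
  refine Finset.sum_bij (fun p _ => insert p.1 p.2) ?_ ?_ ?_ ?_
  · rintro ⟨l, T⟩ h
    simp only [mem_sigma, mem_lozengesAt, mem_tilings] at h ⊢
    exact (IsTiling.insert h.1.2.1 h.1.1.1 h.1.1.2 h.2).2
  · rintro ⟨l, T⟩ h ⟨l', T'⟩ h' e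
    simp only [mem_sigma, mem_lozengesAt, mem_tilings] at h h' e
    obtain ⟨n1, t1⟩ := IsTiling.insert h.1.2.1 h.1.1.1 h.1.1.2 h.2
    obtain ⟨n2, t2⟩ := IsTiling.insert h'.1.2.1 h'.1.1.1 h'.1.1.2 h'.2
    have hll : l = l' :=
      t1.eq_of_mem (Finset.mem_insert_self _ _) (e ▸ Finset.mem_insert_self _ _) h.1.2.2 h'.1.2.2
    subst hll
    have : T = T' := by
      rw [← Finset.erase_insert n1, ← Finset.erase_insert n2, e]
    rw [this]
  · intro T hT
    rw [mem_tilings] at hT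
    obtain ⟨l, ⟨hl, hlt⟩, -⟩ := hT.2 t ht
    refine ⟨⟨l, T.erase l⟩, ?_, Finset.insert_erase hl⟩
    simp only [mem_sigma, mem_lozengesAt, mem_tilings]
    obtain ⟨h1, h2⟩ := hT.1 l hl
    exact ⟨⟨h2, h1, hlt⟩, hT.erase hl⟩
  · rintro ⟨l, T⟩ h
    simp only [mem_sigma, mem_lozengesAt, mem_tilings] at h ⊢
    rw [Finset.prod_insert (IsTiling.insert h.1.2.1 h.1.1.1 h.1.1.2 h.2).1]

theorem tilingGF_empty {K : Type*} [Field K] (wt : TrianglePair → K) : tilingGF wt ∅ = 1 := by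
  have : tilings ∅ = {∅} := by
    ext T
    rw [mem_tilings, Finset.mem_singleton]
    constructor
    · intro h
      refine Finset.eq_empty_of_forall_notMem fun l hl => ?_
      simpa using (h.1 l hl).2.1
    · rintro rfl
      simp [IsTiling]
  simp [tilingGF, this]

/-! ### Clearing a strip from left to right -/

/-- The unit triangles of the strip `j` with abscissas in `[a, L]` outside `S`. -/
def rowPart (j a L : ℤ) (S : Finset ℤ) : Finset UnitTriangle := (Icc a L \ S) ×ˢ {j}

theorem mem_rowPart {j a L : ℤ} {S : Finset ℤ} {t : UnitTriangle} :
    t ∈ rowPart j a L S ↔ (a ≤ t.1 ∧ t.1 ≤ L ∧ t.1 ∉ S) ∧ t.2 = j := by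
  rw [rowPart, Finset.mem_product, mem_singleton, mem_sdiff, mem_Icc, and_assoc (a := _ ≤ _)]

/-- The weight of a vertical lozenge whose center has abscissa `i`. -/
def vertWeight {K : Type*} [Field K] (q : K) (i : ℤ) : K :=
  if i = 0 then 1 / 2 else (q ^ i + q ^ (-i)) / 2

theorem wt₂_vert {K : Type*} [Field K] (q : K) (i j : ℤ) :
    wt₂ q ((i, j + 1), (i, j)) = vertWeight q i := by
  simp [wt₂, IsVertical, vertWeight]

theorem wt₂_right {K : Type*} [Field K] (q : K) (i j : ℤ) :
    wt₂ q ((i, j), (i + 1, j)) = 1 := by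
  simp [wt₂, IsVertical]

theorem wt₂_left {K : Type*} [Field K] (q : K) (i j : ℤ) :
    wt₂ q ((i + 1, j), (i, j)) = 1 := by
  simp [wt₂, IsVertical]

section Row

variable {K : Type*} [Field K] (q : K) {j a L : ℤ} {S : Finset ℤ} {B : Finset UnitTriangle}

theorem rowPart_succ_of_mem (ha : a ∈ S) : rowPart j a L S = rowPart j (a + 1) L S := by
  ext t
  simp only [mem_rowPart]
  constructor
  · rintro ⟨⟨h1, h2, h3⟩, h4⟩
    refine ⟨⟨?_, h2, h3⟩, h4⟩
    rcases h1.lt_or_eq with h | h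
    · omega
    · exact absurd (h ▸ ha) h3
  · rintro ⟨⟨h1, h2, h3⟩, h4⟩
    exact ⟨⟨by omega, h2, h3⟩, h4⟩

theorem rowPart_sdiff_pair (hB : ∀ t ∈ B, j < t.2) :
    (rowPart j a L S ∪ B) \ {(a, j), (a + 1, j)} = rowPart j (a + 2) L S ∪ B := by
  ext ⟨i, k⟩
  have := hB (i, k)
  simp only [mem_sdiff, mem_union, mem_rowPart, mem_insert, mem_singleton, Prod.mk.injEq] at *
  constructor
  · rintro ⟨h | h, h'⟩
    · left; refine ⟨⟨?_, h.1.2⟩, h.2⟩; have := h.1.1; have := h.2; omega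
    · exact Or.inr h
  · rintro (h | h)
    · exact ⟨Or.inl ⟨⟨by omega, h.1.2⟩, h.2⟩, by omega⟩
    · exact ⟨Or.inr h, by have := this h; omega⟩

theorem rowPart_sdiff_vert (hB : ∀ t ∈ B, j < t.2) :
    (rowPart j a L S ∪ B) \ {(a, j + 1), (a, j)} =
      rowPart j (a + 1) L S ∪ B.erase (a, j + 1) := by
  ext ⟨i, k⟩
  have := hB (i, k)
  simp only [mem_sdiff, mem_union, mem_rowPart, mem_insert, mem_singleton, Prod.mk.injEq,
    mem_erase, ne_eq] at *
  constructor
  · rintro ⟨h | h, h'⟩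
    · left; refine ⟨⟨?_, h.1.2⟩, h.2⟩; have := h.1.1; have := h.2; omega
    · exact Or.inr ⟨by tauto, h⟩
  · rintro (h | h)
    · exact ⟨Or.inl ⟨⟨by omega, h.1.2⟩, h.2⟩, by omega⟩
    · exact ⟨Or.inr h.2, by have := this h.2; omega⟩

theorem isLozenge_cases {l : TrianglePair} (h : IsLozenge l) :
    (∃ i k, Even (i + k) ∧ l = ((i, k), (i - 1, k))) ∨
    (∃ i k, Even (i + k) ∧ l = ((i, k), (i + 1, k))) ∨
    (∃ i k, Even (i + k) ∧ l = ((i, k), (i, k - 1))) := by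
  obtain ⟨⟨i, k⟩, m⟩ := l
  obtain ⟨h1, h2⟩ := h
  simp only [IsUp, IsVertical] at *
  rcases h2 with rfl | rfl | rfl
  · exact Or.inl ⟨i, k, h1, rfl⟩
  · exact Or.inr (Or.inl ⟨i, k, h1, rfl⟩)
  · exact Or.inr (Or.inr ⟨i, k, h1, rfl⟩)

/-- The lozenges covering an up-pointing triangle with nothing to its left and below. -/
theorem lozengesAt_up (hup : Even (a + j)) (haL : a < L) (haS : a ∉ S) (haS' : a + 1 ∉ S)
    (hB : ∀ t ∈ B, j < t.2) :
    lozengesAt (rowPart j a L S ∪ B) (a, j) = {((a, j), (a + 1, j))} := by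
  ext l
  rw [mem_lozengesAt, mem_singleton]
  constructor
  · rintro ⟨⟨h1, h2⟩, hl, ht⟩
    rw [mem_union, mem_rowPart] at h1 h2
    have b1 := hB l.1
    have b2 := hB l.2
    rcases isLozenge_cases hl with ⟨i, k, e, rfl⟩ | ⟨i, k, e, rfl⟩ | ⟨i, k, e, rfl⟩ <;>
      simp only [Prod.mk.injEq] at * <;> grind
  · rintro rfl
    simp only [mem_union, mem_rowPart, IsLozenge, IsUp]
    grind

theorem lozengesAt_up_last (hup : Even (a + j)) (hB : ∀ t ∈ B, j < t.2) :
    lozengesAt (rowPart j a a S ∪ B) (a, j) = ∅ := by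
  refine Finset.eq_empty_of_forall_notMem fun l hl => ?_
  rw [mem_lozengesAt] at hl
  obtain ⟨⟨h1, h2⟩, hl, ht⟩ := hl
  rw [mem_union, mem_rowPart] at h1 h2
  have b1 := hB l.1
  have b2 := hB l.2
  rcases isLozenge_cases hl with ⟨i, k, e, rfl⟩ | ⟨i, k, e, rfl⟩ | ⟨i, k, e, rfl⟩ <;>
    simp only [Prod.mk.injEq] at * <;> grind

open Classical in
theorem lozengesAt_down (hdown : Odd (a + j)) (haL : a < L) (haS : a ∉ S)
    (hB : ∀ t ∈ B, j < t.2) :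
    lozengesAt (rowPart j a L S ∪ B) (a, j) =
      (if (a, j + 1) ∈ B then {((a, j + 1), (a, j))} else ∅) ∪
        (if a + 1 ∈ S then ∅ else {((a + 1, j), (a, j))}) := by
  ext l
  rw [mem_lozengesAt]
  constructor
  · rintro ⟨⟨h1, h2⟩, hl, ht⟩
    rw [mem_union, mem_rowPart] at h1 h2
    have b1 := hB l.1
    have b2 := hB l.2
    rcases isLozenge_cases hl with ⟨i, k, e, rfl⟩ | ⟨i, k, e, rfl⟩ | ⟨i, k, e, rfl⟩ <;>
      simp only [Prod.mk.injEq] at * <;> grind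
  · intro h
    rw [mem_union] at h
    rcases h with h | h
    · split_ifs at h with h'
      · rw [mem_singleton] at h
        subst h
        simp only [mem_union, mem_rowPart, IsLozenge, IsUp, IsVertical]
        grind
      · simp at h
    · split_ifs at h with h'
      · simp at h
      · rw [mem_singleton] at h
        subst h
        simp only [mem_union, mem_rowPart, IsLozenge, IsUp, IsVertical]
        grind

theorem tilingGF_row_up (hup : Even (a + j)) (haL : a < L) (haS : a ∉ S) (haS' : a + 1 ∉ S)
    (hB : ∀ t ∈ B, j < t.2) :
    tilingGF (wt₂ q) (rowPart j a L S ∪ B) = tilingGF (wt₂ q) (rowPart j (a + 2) L S ∪ B) := by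
  have hm : (a, j) ∈ rowPart j a L S ∪ B := by
    simp only [mem_union, mem_rowPart]; grind
  rw [tilingGF_expand _ _ hm, lozengesAt_up hup haL haS haS' hB, sum_singleton, wt₂_right, one_mul,
    rowPart_sdiff_pair hB]

theorem tilingGF_row_up_last (hup : Even (a + j)) (haS : a ∉ S) (hB : ∀ t ∈ B, j < t.2) :
    tilingGF (wt₂ q) (rowPart j a a S ∪ B) = 0 := by
  have hm : (a, j) ∈ rowPart j a a S ∪ B := by
    simp only [mem_union, mem_rowPart]; grind
  rw [tilingGF_expand _ _ hm, lozengesAt_up_last hup hB, sum_empty]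

-- The only branching: a leftmost down-pointing triangle joins the triangle above it or the one to
-- its right.
open Classical in
theorem tilingGF_row_down (hdown : Odd (a + j)) (haL : a < L) (haS : a ∉ S)
    (hB : ∀ t ∈ B, j < t.2) :
    tilingGF (wt₂ q) (rowPart j a L S ∪ B) =
      (if (a, j + 1) ∈ B then
        vertWeight q a * tilingGF (wt₂ q) (rowPart j (a + 1) L S ∪ B.erase (a, j + 1)) else 0) +
      if a + 1 ∈ S then 0 else tilingGF (wt₂ q) (rowPart j (a + 2) L S ∪ B) := by
  have hm : (a, j) ∈ rowPart j a L S ∪ B := by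
    simp only [mem_union, mem_rowPart]; grind
  rw [tilingGF_expand _ _ hm, lozengesAt_down hdown haL haS hB, sum_union]
  · congr 1
    · split_ifs
      · rw [sum_singleton, wt₂_vert, rowPart_sdiff_vert hB]
      · simp
    · split_ifs
      · simp
      · rw [sum_singleton, wt₂_left, one_mul, ← rowPart_sdiff_pair hB, Finset.pair_comm]
  · split_ifs <;> simp

/-- A leftmost up-pointing triangle must join its right neighbour, which exposes another up-pointing
one; this repeats until a hole. -/
theorem tilingGF_row_up_run {c : ℤ} (hup : Even (a + j)) (hc : Even (c + j)) (hac : a ≤ c)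
    (hcL : c ≤ L) (hS : ∀ i ∈ S, a ≤ i → c ≤ i) (hB : ∀ t ∈ B, j < t.2) :
    tilingGF (wt₂ q) (rowPart j a L S ∪ B) = tilingGF (wt₂ q) (rowPart j c L S ∪ B) := by
  obtain ⟨n, hn⟩ : ∃ n : ℕ, c = a + 2 * n := by
    refine ⟨((c - a) / 2).toNat, ?_⟩
    have : Even (c - a) := by
      have := hc.sub hup
      simpa using this
    obtain ⟨r, hr⟩ := this
    omega
  induction n generalizing a with
  | zero => simp [hn]
  | succ n ih =>
    push_cast at hn
    rw [tilingGF_row_up q hup (by omega) (fun h => by have := hS _ h; omega)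
      (fun h => by have := hS _ h; omega) hB]
    refine ih ?_ (by omega) (fun i hi h => hS i hi (by omega)) (by omega)
    rw [show a + 2 + j = a + j + 2 by ring]
    exact hup.add even_two

theorem tilingGF_row_up_end (hup : Even (a + j)) (hL : Even (L + j)) (haL : a ≤ L)
    (hS : ∀ i ∈ S, a ≤ i → L < i) (hB : ∀ t ∈ B, j < t.2) :
    tilingGF (wt₂ q) (rowPart j a L S ∪ B) = 0 := by
  rw [tilingGF_row_up_run q hup hL haL le_rfl (fun i hi h => (hS i hi h).le) hB]
  exact tilingGF_row_up_last q hL (fun h => by have := hS _ h haL; omega) hB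

/-- A vertical lozenge here would start a run of up-pointing triangles with no hole to stop it,
stranding the last triangle of the strip. So everything is paired horizontally. -/
theorem tilingGF_row_down_end (hdown : Odd (a + j)) (hL : Even (L + j)) (haL : a ≤ L + 1)
    (hS : ∀ i ∈ S, a ≤ i → L < i) (hB : ∀ t ∈ B, j < t.2) :
    tilingGF (wt₂ q) (rowPart j a L S ∪ B) = tilingGF (wt₂ q) B := by
  classical
  obtain ⟨n, hn⟩ : ∃ n : ℕ, L + 1 = a + 2 * n := by
    refine ⟨((L + 1 - a) / 2).toNat, ?_⟩
    obtain ⟨r, hr⟩ := hdown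
    obtain ⟨r', hr'⟩ := hL
    omega
  induction n generalizing a with
  | zero =>
    have : rowPart j a L S = ∅ := by
      refine Finset.eq_empty_of_forall_notMem fun t ht => ?_
      rw [mem_rowPart] at ht
      omega
    rw [this, empty_union]
  | succ n ih =>
    push_cast at hn
    rw [tilingGF_row_down q hdown (by omega) (fun h => by have := hS _ h; omega) hB,
      if_neg (c := a + 1 ∈ S) (fun h => by have := hS _ h; omega),
      ih (by rw [show a + 2 + j = a + j + 2 by ring]; exact hdown.add_even even_two)
        (by omega) (fun i hi h => hS i hi (by omega)) (by omega),
      tilingGF_row_up_end q (by rw [show a + 1 + j = a + j + 1 by ring]; exact hdown.add_one)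
        hL (by omega) (fun i hi h => hS i hi (by omega))
        (fun t ht => hB t (Finset.mem_of_mem_erase ht))]
    simp

/-- Exactly one vertical lozenge occurs before the hole `c`: without one, the down-pointing triangle
just left of `c` has no partner, and after one the run up to `c` is forced. Beyond `c` the strip
again starts with a down-pointing triangle. -/
theorem tilingGF_row_down_run {c : ℤ} (hdown : Odd (a + j)) (hc : Even (c + j)) (hac : a < c)
    (hcL : c ≤ L) (hcS : c ∈ S) (hS : ∀ i ∈ S, a ≤ i → c ≤ i) (hB : ∀ t ∈ B, j < t.2)
    (hB' : ∀ t, a ≤ t → t < c → Odd (t + j) → (t, j + 1) ∈ B) :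
    tilingGF (wt₂ q) (rowPart j a L S ∪ B) =
      ∑ t ∈ Ico a c with Odd (t + j),
        vertWeight q t * tilingGF (wt₂ q) (rowPart j (c + 1) L S ∪ B.erase (t, j + 1)) := by
  classical
  obtain ⟨n, hn⟩ : ∃ n : ℕ, c = a + 1 + 2 * n := by
    refine ⟨((c - 1 - a) / 2).toNat, ?_⟩
    obtain ⟨r, hr⟩ := hdown
    obtain ⟨r', hr'⟩ := hc
    omega
  have key : ∀ a, Odd (a + j) → a < c → (∀ i ∈ S, a ≤ i → c ≤ i) →
      tilingGF (wt₂ q) (rowPart j (a + 1) L S ∪ B.erase (a, j + 1)) =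
        tilingGF (wt₂ q) (rowPart j (c + 1) L S ∪ B.erase (a, j + 1)) := by
    intro a hdown hac hS
    rw [tilingGF_row_up_run q (by rw [show a + 1 + j = a + j + 1 by ring]; exact hdown.add_one)
      hc hac hcL (fun i hi h => hS i hi (by omega))
      (fun t ht => hB t (Finset.mem_of_mem_erase ht)), rowPart_succ_of_mem hcS]
  induction n generalizing a with
  | zero =>
    have hca : a + 1 = c := by simp [hn]
    have : {t ∈ Ico a c | Odd (t + j)} = {a} := by
      ext t
      simp only [mem_filter, mem_Ico, mem_singleton]
      constructor
      · omega
      · rintro rfl; exact ⟨by omega, hdown⟩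
    rw [tilingGF_row_down q hdown (by omega) (fun h => by have := hS _ h; omega) hB,
      if_pos (hB' a le_rfl hac hdown), if_pos (hca ▸ hcS), key a hdown hac hS, this,
      sum_singleton, add_zero]
  | succ n ih =>
    push_cast at hn
    have hd2 : Odd (a + 2 + j) := by
      rw [show a + 2 + j = a + j + 2 by ring]; exact hdown.add_even even_two
    have : {t ∈ Ico a c | Odd (t + j)} = insert a {t ∈ Ico (a + 2) c | Odd (t + j)} := by
      ext t
      simp only [mem_filter, mem_Ico, mem_insert]
      constructor
      · rintro ⟨h1, h2⟩
        by_cases h : t = a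
        · exact Or.inl h
        · right
          refine ⟨⟨?_, h1.2⟩, h2⟩
          obtain ⟨r, hr⟩ := hdown
          obtain ⟨r', hr'⟩ := h2
          omega
      · rintro (rfl | h)
        · exact ⟨by omega, hdown⟩
        · exact ⟨by omega, h.2⟩
    rw [tilingGF_row_down q hdown (by omega) (fun h => by have := hS _ h; omega) hB,
      if_pos (hB' a le_rfl hac hdown), if_neg (fun h => by have := hS _ h; omega),
      key a hdown hac hS, this, sum_insert (by simp),
      ih hd2 (by omega) (fun i hi h => hS i hi (by omega))
        (fun t h => hB' t (by omega)) (by omega)]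

end Row

/-! ### A whole strip as a sum over interlacing abscissas -/

/-- The lower ends of the gaps between `a` and the entries of `s`. -/
def gapStart {m : ℕ} (a : ℤ) (s : Fin m → ℤ) (i : Fin m) : ℤ :=
  (Fin.cons a (fun k => s k + 1) : Fin (m + 1) → ℤ) i.castSucc

theorem gapStart_zero {m : ℕ} (a : ℤ) (s : Fin (m + 1) → ℤ) : gapStart a s 0 = a := rfl

theorem gapStart_succ {m : ℕ} (a : ℤ) (s : Fin (m + 1) → ℤ) (i : Fin m) :
    gapStart a s i.succ = s i.castSucc + 1 := by
  simp only [gapStart]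
  rw [← Fin.succ_castSucc, Fin.cons_succ]

theorem gapStart_succ' {m : ℕ} (a : ℤ) (s : Fin (m + 1) → ℤ) (i : Fin m) :
    gapStart a s i.succ = gapStart (s 0 + 1) (Fin.tail s) i := by
  rw [gapStart_succ]
  simp only [gapStart]
  cases m with
  | zero => exact i.elim0
  | succ m =>
    refine Fin.cases ?_ (fun k => ?_) i
    · rfl
    · rw [← Fin.succ_castSucc, Fin.cons_succ, Fin.tail, Fin.succ_castSucc]

/-- The integers `t` with `t + j` odd in the gap between two consecutive entries of `s`. -/
def gap {m : ℕ} (j a : ℤ) (s : Fin m → ℤ) (i : Fin m) : Finset ℤ :=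
  {t ∈ Ico (gapStart a s i) (s i) | Odd (t + j)}

theorem sum_piFinset_succ {m : ℕ} {K : Type*} [AddCommMonoid K] (I : Fin (m + 1) → Finset ℤ)
    (f : (Fin (m + 1) → ℤ) → K) :
    ∑ t ∈ Fintype.piFinset I, f t =
      ∑ c ∈ I 0, ∑ t ∈ Fintype.piFinset (Fin.tail I), f (Fin.cons c t) := by
  rw [← Finset.sum_product']
  refine Finset.sum_nbij' (fun t => (t 0, Fin.tail t)) (fun p => Fin.cons p.1 p.2) ?_ ?_ ?_ ?_ ?_
  · intro t ht
    rw [Fintype.mem_piFinset] at ht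
    rw [mem_product, Fintype.mem_piFinset]
    exact ⟨ht 0, fun i => ht i.succ⟩
  · rintro ⟨c, t⟩ h
    rw [mem_product, Fintype.mem_piFinset] at h
    rw [Fintype.mem_piFinset]
    exact Fin.cases h.1 h.2
  · intro t _
    exact Fin.cons_self_tail t
  · rintro ⟨c, t⟩ _
    simp
  · intro t _
    simp

/-- Removal of a strip whose leftmost unit triangle is down-pointing. -/
theorem tilingGF_strip_down {K : Type*} [Field K] (q : K) {m : ℕ} {j a L : ℤ} {S : Finset ℤ}
    {B : Finset UnitTriangle} (s : Fin m → ℤ) (hs : StrictMono s) (hdown : Odd (a + j))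
    (hL : Even (L + j)) (haL : a ≤ L + 1) (has : ∀ i, a < s i) (hsL : ∀ i, s i ≤ L)
    (hsj : ∀ i, Even (s i + j)) (hS : ∀ c, a ≤ c → c ≤ L → (c ∈ S ↔ ∃ i, s i = c))
    (hB : ∀ t ∈ B, j < t.2)
    (hB' : ∀ t i, a ≤ t → t < s i → Odd (t + j) → (t, j + 1) ∈ B) :
    tilingGF (wt₂ q) (rowPart j a L S ∪ B) =
      ∑ t ∈ Fintype.piFinset (gap j a s), (∏ i, vertWeight q (t i)) *
        tilingGF (wt₂ q) (B \ univ.image fun i => (t i, j + 1)) := by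
  induction m generalizing a B with
  | zero =>
    rw [tilingGF_row_down_end q hdown hL haL (fun i hi h => ?_) hB]
    · simp
    · by_contra hh
      obtain ⟨i, -⟩ := (hS i h (not_lt.1 hh)).1 hi
      exact i.elim0
  | succ m ih =>
    have h0 : ∀ i, s 0 ≤ s i := fun i => hs.monotone (Fin.zero_le i)
    rw [tilingGF_row_down_run q (c := s 0) hdown (hsj 0) (has 0) (hsL 0)
      ((hS _ (has 0).le (hsL 0)).2 ⟨0, rfl⟩) (fun i hi h => ?_) hB (fun t => hB' t 0),
      sum_piFinset_succ]
    · refine Finset.sum_congr rfl fun c hc => ?_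
      rw [gap, gapStart_zero, mem_filter, mem_Ico] at hc
      rw [ih (Fin.tail s) (fun i k h => hs (Fin.succ_lt_succ_iff.2 h))
        (by rw [show s 0 + 1 + j = s 0 + j + 1 by ring]; exact (hsj 0).add_one)
        (by have := hsL 0; omega)
        (fun i => ?_) (fun i => hsL _) (fun i => hsj _) (fun d h1 h2 => ?_)
        (fun t ht => hB t (Finset.mem_of_mem_erase ht)) (fun t i h1 h2 h3 => ?_), Finset.mul_sum]
      · have : Fin.tail (gap j a s) = gap j (s 0 + 1) (Fin.tail s) := by
          funext i
          simp only [Fin.tail, gap, gapStart_succ']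
        rw [this]
        refine Finset.sum_congr rfl fun t _ => ?_
        rw [Fin.prod_univ_succ, mul_assoc]
        simp only [Fin.cons_zero, Fin.cons_succ]
        congr 3
        ext p
        simp only [mem_sdiff, mem_erase, mem_image, mem_univ, true_and, Fin.exists_fin_succ,
          Fin.cons_zero, Fin.cons_succ, not_or, ne_eq]
        tauto
      -- All entries have the same parity, so distinct ones differ by at least two.
      · have h1 : s 0 < s i.succ := hs (Fin.succ_pos i)
        have h2 := hsj 0
        have h3 := hsj i.succ
        simp only [Fin.tail]
        grind
      · rw [hS d (by have := has 0; omega) h2, Fin.exists_fin_succ]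
        simp only [Fin.tail]
        constructor
        · rintro (h | h)
          · omega
          · exact h
        · exact Or.inr
      · refine Finset.mem_erase.2 ⟨?_, hB' t i.succ (by have := has 0; omega) h2 h3⟩
        simp only [ne_eq, Prod.mk.injEq]
        omega
    · by_cases hh : i ≤ L
      · obtain ⟨k, rfl⟩ := (hS i h hh).1 hi
        exact h0 k
      · have := hsL 0
        omega

/-- Removal of a strip whose leftmost unit triangle is up-pointing. -/
theorem tilingGF_strip_up {K : Type*} [Field K] (q : K) {m : ℕ} {j a L : ℤ} {S : Finset ℤ}
    {B : Finset UnitTriangle} (s : Fin (m + 1) → ℤ) (hs : StrictMono s) (hup : Even (a + j))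
    (hL : Even (L + j)) (has : ∀ i, a ≤ s i) (hsL : ∀ i, s i ≤ L)
    (hsj : ∀ i, Even (s i + j)) (hS : ∀ c, a ≤ c → c ≤ L → (c ∈ S ↔ ∃ i, s i = c))
    (hB : ∀ t ∈ B, j < t.2)
    (hB' : ∀ t (i : Fin m), a ≤ t → t < s i.succ → Odd (t + j) → (t, j + 1) ∈ B) :
    tilingGF (wt₂ q) (rowPart j a L S ∪ B) =
      ∑ t ∈ Fintype.piFinset (gap j (s 0 + 1) (Fin.tail s)), (∏ i, vertWeight q (t i)) *
        tilingGF (wt₂ q) (B \ univ.image fun i => (t i, j + 1)) := by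
  have h0 : ∀ i, s 0 ≤ s i := fun i => hs.monotone (Fin.zero_le i)
  -- The stretch up to the first hole is forced and has no vertical lozenge, so `m + 1` holes leave
  -- only `m` gaps.
  rw [tilingGF_row_up_run q (c := s 0) hup (hsj 0) (has 0) (hsL 0) (fun i hi h => ?_) hB,
    rowPart_succ_of_mem ((hS _ (has 0) (hsL 0)).2 ⟨0, rfl⟩)]
  · refine tilingGF_strip_down q (Fin.tail s) (fun i k h => hs (Fin.succ_lt_succ_iff.2 h))
        (by rw [show s 0 + 1 + j = s 0 + j + 1 by ring]; exact (hsj 0).add_one) hL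
        (by have := hsL 0; omega)
        (fun i => ?_) (fun i => hsL _) (fun i => hsj _) (fun d h1 h2 => ?_)
        hB (fun t i h1 h2 h3 => hB' t i (by have := has 0; omega) h2 h3)
    · have h1 : s 0 < s i.succ := hs (Fin.succ_pos i)
      have h2 := hsj 0
      have h3 := hsj i.succ
      simp only [Fin.tail]
      grind
    · rw [hS d (by have := has 0; omega) h2, Fin.exists_fin_succ]
      simp only [Fin.tail]
      constructor
      · rintro (h | h)
        · omega
        · exact h
      · exact Or.inr
  · by_cases hh : i ≤ L
    · obtain ⟨k, rfl⟩ := (hS i h hh).1 hi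
      exact h0 k
    · have := hsL 0
      omega

/-! ### Chebyshev-type polynomials and the Vandermonde determinant -/

section Chebyshev

open Polynomial

variable {K : Type*} [Field K]

/-- Monic polynomials with the Chebyshev recursion `p (n + 2) = X * p (n + 1) - p n`, up to the
choice of the first terms. -/
def chebyshevLike (c d : K) : ℕ → K[X]
  | 0 => 1
  | 1 => X + C c
  | 2 => X * (X + C c) - C d
  | (n + 3) => X * chebyshevLike c d (n + 2) - chebyshevLike c d (n + 1)

theorem chebyshevLike_monic_natDegree (c d : K) (n : ℕ) :
    (chebyshevLike c d n).Monic ∧ (chebyshevLike c d n).natDegree = n := by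
  have step : ∀ (p r : K[X]) (m : ℕ), p.Monic ∧ p.natDegree = m → r.natDegree ≤ m →
      (X * p - r).Monic ∧ (X * p - r).natDegree = m + 1 := by
    rintro p r m ⟨hp, hm⟩ hr
    have h1 : (X * p).Monic := monic_X.mul hp
    have h2 : (X * p).natDegree = m + 1 := by rw [natDegree_X_mul hp.ne_zero, hm]
    have hlt : r.degree < (X * p).degree := by
      rw [degree_eq_natDegree h1.ne_zero, h2]
      exact lt_of_le_of_lt degree_le_natDegree (by exact_mod_cast Nat.lt_succ_of_le hr)
    exact ⟨h1.sub_of_left hlt, by rw [natDegree_sub_eq_left_of_natDegree_lt (by omega), h2]⟩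
  induction n using Nat.strong_induction_on with
  | _ n ih =>
    match n with
    | 0 => exact ⟨monic_one, natDegree_one⟩
    | 1 => exact ⟨monic_X_add_C c, natDegree_X_add_C c⟩
    | 2 => exact step _ _ 1 ⟨monic_X_add_C c, natDegree_X_add_C c⟩ (by simp)
    | (n + 3) =>
      exact step _ _ (n + 2) (ih (n + 2) (by omega)) (by rw [(ih (n + 1) (by omega)).2]; omega)

theorem eval_chebyshevLike {c d y : K} {f : ℕ → K} (h1 : f 1 = (y + c) * f 0)
    (h2 : f 2 = y * f 1 - d * f 0) (h3 : ∀ n, f (n + 3) = y * f (n + 2) - f (n + 1)) (n : ℕ) :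
    f n = f 0 * (chebyshevLike c d n).eval y := by
  induction n using Nat.strong_induction_on with
  | _ n ih =>
    match n with
    | 0 => simp [chebyshevLike]
    | 1 => simp [chebyshevLike, h1, mul_comm]
    | 2 => simp [chebyshevLike, h2, h1]; ring
    | (n + 3) =>
      rw [h3, ih (n + 2) (by omega), ih (n + 1) (by omega), chebyshevLike]
      simp only [eval_sub, eval_mul, eval_X]
      ring

/-- Monicity with degree `k` in column `k` makes the determinant independent of `c` and `d`. Each
transfer can therefore use one family before summation and another after it. -/
theorem det_eval_chebyshevLike (c d : K) {m : ℕ} (y : Fin m → K) :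
    (Matrix.of fun i k : Fin m => (chebyshevLike c d k).eval (y i)).det =
      (Matrix.vandermonde y).det :=
  (Matrix.det_eval_matrixOfPolynomials_eq_det_vandermonde y (fun k => chebyshevLike c d k)
    (fun k => (chebyshevLike_monic_natDegree c d k).2)
    (fun k => (chebyshevLike_monic_natDegree c d k).1)).symm

end Chebyshev

/-! ### Summing determinants row by row -/

section Determinants

variable {K : Type*} [Field K]

theorem sum_piFinset_det {m : ℕ} (I : Fin m → Finset ℤ) (g : Fin m → ℤ → K) :
    ∑ t ∈ Fintype.piFinset I, (Matrix.of fun i k => g k (t i)).det =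
      (Matrix.of fun i k => ∑ t ∈ I i, g k t).det := by
  have h := (Matrix.detRowAlternating (n := Fin m) (R := K)).toMultilinearMap.map_sum_finset
    (fun (_ : Fin m) (t : ℤ) (k : Fin m) => g k t) I
  refine Eq.trans ?_ (h.symm.trans ?_)
  · rfl
  · show Matrix.det _ = _
    congr 1
    ext i k
    simp [Finset.sum_apply]

theorem sum_piFinset_prod_mul_vandermonde {m : ℕ} (I : Fin m → Finset ℤ) (w Y : ℤ → K)
    (g : ℕ → ℤ → K) (c d : K)
    (hg : ∀ k i, ∀ t ∈ I i, w t * (chebyshevLike c d k).eval (Y t) = g k t) :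
    ∑ t ∈ Fintype.piFinset I, (∏ i, w (t i)) * (Matrix.vandermonde fun i => Y (t i)).det =
      (Matrix.of fun i k : Fin m => ∑ t ∈ I i, g k t).det := by
  rw [← sum_piFinset_det I (fun k => g k)]
  refine Finset.sum_congr rfl fun t ht => ?_
  rw [Fintype.mem_piFinset] at ht
  rw [← det_eval_chebyshevLike c d, ← Matrix.det_mul_column]
  congr 1
  ext i k
  exact hg k i _ (ht i)

theorem det_telescope {m : ℕ} (A B : Matrix (Fin (m + 1)) (Fin (m + 1)) K)
    (h0 : ∀ k, B 0 k = A 0 k) (hsucc : ∀ (i : Fin m) k, B i.succ k = A i.succ k - A i.castSucc k) :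
    B.det = A.det :=
  (Matrix.det_eq_of_forall_row_eq_smul_add_pred (fun _ => (1 : K)) (fun k => (h0 k).symm)
    fun i k => by rw [hsucc]; ring).symm

/-- Subtracting consecutive rows of the larger matrix turns its column of ones into `(1, 0, …, 0)`;
expand along that column. -/
theorem det_differences {m : ℕ} (G : ℕ → Fin (m + 1) → K) :
    (Matrix.of fun i k : Fin m => G k i.succ - G k i.castSucc).det =
      (Matrix.of fun i k : Fin (m + 1) =>
        (Fin.cons 1 (fun k : Fin m => G k i) : Fin (m + 1) → K) k).det := by
  rw [← det_telescope (Matrix.of fun i k : Fin (m + 1) =>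
        (Fin.cons 1 (fun k : Fin m => G k i) : Fin (m + 1) → K) k)
      (Matrix.of (Fin.cons (Fin.cons 1 fun k : Fin m => G k 0)
        fun i => Fin.cons 0 fun k : Fin m => G k i.succ - G k i.castSucc)) ?_ ?_]
  · rw [Matrix.det_succ_column_zero, Fin.sum_univ_succ]
    simp [Matrix.submatrix]
  · intro k
    simp
  · intro i k
    refine Fin.cases ?_ (fun k => ?_) k <;> simp

/-- Telescoping in steps of two: `G` is evaluated at the parity opposite to that of the summation
variable. -/
theorem sum_gap {j lo hi : ℤ} {g G : ℤ → K} (hlo : Odd (lo + j)) (hhi : Even (hi + j))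
    (hle : lo ≤ hi + 1) (hg : ∀ t, lo ≤ t → t < hi → Odd (t + j) → g t = G (t + 1) - G (t - 1)) :
    ∑ t ∈ Ico lo hi with Odd (t + j), g t = G hi - G (lo - 1) := by
  obtain ⟨n, hn⟩ : ∃ n : ℕ, hi = lo - 1 + 2 * n := by
    refine ⟨((hi + 1 - lo) / 2).toNat, ?_⟩
    obtain ⟨r, hr⟩ := hlo
    obtain ⟨r', hr'⟩ := hhi
    omega
  subst hn
  clear hle hhi
  induction n with
  | zero => simp
  | succ n ih =>
    have hl : Odd (lo + 2 * n + j) := by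
      obtain ⟨r, hr⟩ := hlo
      exact ⟨r + n, by omega⟩
    have : {t ∈ Ico lo (lo - 1 + 2 * ((n + 1 : ℕ) : ℤ)) | Odd (t + j)} =
        insert (lo + 2 * (n : ℤ)) {t ∈ Ico lo (lo - 1 + 2 * (n : ℤ)) | Odd (t + j)} := by
      ext t
      simp only [mem_filter, mem_Ico, mem_insert]
      push_cast
      constructor
      · rintro ⟨h1, h2⟩
        by_cases h : t = lo + 2 * n
        · exact Or.inl h
        · right
          refine ⟨⟨h1.1, ?_⟩, h2⟩
          obtain ⟨r, hr⟩ := hlo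
          obtain ⟨r', hr'⟩ := h2
          omega
      · rintro (rfl | h)
        · exact ⟨by omega, hl⟩
        · exact ⟨by omega, h.2⟩
    rw [this, sum_insert (by simp), ih (fun t h1 h2 => hg t h1 (by push_cast; omega)),
      hg _ (by omega) (by push_cast; omega) hl]
    push_cast
    rw [show lo - 1 + 2 * ((n : ℤ) + 1) = lo + 2 * n + 1 by ring,
      show lo + 2 * (n : ℤ) - 1 = lo - 1 + 2 * n by ring]
    ring

end Determinants

/-! ### Hyperbolic functions in `q` and the transfer through one strip -/

section Transfer

variable {K : Type*} [Field K] {q : K}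

/-- `q ^ r - q ^ (-r)`. -/
def qSinh (q : K) (r : ℤ) : K := q ^ r - q ^ (-r)

/-- `q ^ r + q ^ (-r)`. -/
def qCosh (q : K) (r : ℤ) : K := q ^ r + q ^ (-r)

theorem qSinh_natCast_mul (n : ℕ) (t : ℤ) : qSinh q (n * t) = (q ^ t) ^ n - (q ^ (-t)) ^ n := by
  rw [qSinh, ← mul_neg, mul_comm, zpow_mul, zpow_natCast, mul_comm, zpow_mul, zpow_natCast]

theorem qCosh_natCast_mul (n : ℕ) (t : ℤ) : qCosh q (n * t) = (q ^ t) ^ n + (q ^ (-t)) ^ n := by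
  rw [qCosh, ← mul_neg, mul_comm, zpow_mul, zpow_natCast, mul_comm, zpow_mul, zpow_natCast]

theorem qCosh_two_mul (t : ℤ) : qCosh q (2 * t) = (q ^ t) ^ 2 + (q ^ (-t)) ^ 2 := by
  simpa using qCosh_natCast_mul (q := q) 2 t

theorem qSinh_mul_qSinh (hq : q ≠ 0) (a b : ℤ) :
    qSinh q a * qSinh q b = qCosh q (a + b) - qCosh q (a - b) := by
  simp only [qSinh, qCosh, zpow_add₀ hq, zpow_sub₀ hq, zpow_neg]
  have := zpow_ne_zero a hq
  have := zpow_ne_zero b hq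
  field_simp
  ring

theorem qSinh_add_sub_qSinh_sub (hq : q ≠ 0) (a b : ℤ) :
    qSinh q (a + b) - qSinh q (a - b) = qCosh q a * qSinh q b := by
  simp only [qSinh, qCosh, zpow_add₀ hq, zpow_sub₀ hq, zpow_neg]
  have := zpow_ne_zero a hq
  have := zpow_ne_zero b hq
  field_simp
  ring

theorem zpow_mul_zpow_neg (hq : q ≠ 0) (t : ℤ) : q ^ t * q ^ (-t) = 1 := by
  rw [← zpow_add₀ hq, add_neg_cancel, zpow_zero]

theorem qSinh_odd_mul (hq : q ≠ 0) (k : ℕ) (t : ℤ) :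
    qSinh q ((2 * k + 1 : ℕ) * t) =
      qSinh q t * (chebyshevLike 1 1 k).eval (qCosh q (2 * t)) := by
  have h := zpow_mul_zpow_neg hq t
  have := eval_chebyshevLike (c := (1 : K)) (d := 1) (y := qCosh q (2 * t))
    (f := fun k => qSinh q ((2 * k + 1 : ℕ) * t)) ?_ ?_ ?_ k
  · simpa using this
  all_goals
    intros
    simp only [qSinh_natCast_mul, qCosh_two_mul]
    generalize q ^ t = x at *
    generalize q ^ (-t) = z at *
    have hx : x ^ 2 * z ^ 2 = 1 := by rw [← mul_pow, h, one_pow]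
  · linear_combination (x - z) * h
  · linear_combination (z - x) * hx
  · rename_i n
    linear_combination -(x ^ (2 * (n + 1) + 1) - z ^ (2 * (n + 1) + 1)) * hx

/-- The sequence `qCosh q ((2k+1)t)` obeys the recursion with first factor `y - 1`. At `t = 0` one
has `y = 2`, and the recursion keeps the exceptional value `1 / 2` constant in `k`. -/
theorem vertWeight_mul_eval (hq : q ≠ 0) (k : ℕ) (t : ℤ) :
    vertWeight q t * (chebyshevLike (-1) 1 k).eval (qCosh q (2 * t)) =
      if t = 0 then 1 / 2 else qCosh q ((2 * k + 1 : ℕ) * t) / 2 := by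
  have h := zpow_mul_zpow_neg hq t
  have := eval_chebyshevLike (c := (-1 : K)) (d := 1) (y := qCosh q (2 * t))
    (f := fun k => if t = 0 then 1 / 2 else qCosh q ((2 * k + 1 : ℕ) * t) / 2) ?_ ?_ ?_ k
  · rw [this]
    simp [vertWeight, qCosh]
  all_goals
    intros
    by_cases h0 : t = 0
    · simp only [h0, if_true, qCosh]
      norm_num <;> ring
    simp only [if_neg h0, qCosh_natCast_mul, qCosh_two_mul]
    generalize q ^ t = x at *
    generalize q ^ (-t) = z at *
    have hx : x ^ 2 * z ^ 2 = 1 := by rw [← mul_pow, h, one_pow]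
  · linear_combination -(x + z) / 2 * h
  · linear_combination -(x + z) / 2 * hx
  · rename_i n
    linear_combination -(x ^ (2 * (n + 1) + 1) + z ^ (2 * (n + 1) + 1)) / 2 * hx

theorem vertWeight_mul_qSinh_mul_eval (hq : q ≠ 0) (k : ℕ) {t : ℤ} (h0 : t ≠ 0) :
    vertWeight q t * qSinh q t * (chebyshevLike 0 1 k).eval (qCosh q (2 * t)) =
      qSinh q ((2 * (k + 1) : ℕ) * t) / 2 := by
  have h := zpow_mul_zpow_neg hq t
  have := eval_chebyshevLike (c := (0 : K)) (d := 1) (y := qCosh q (2 * t))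
    (f := fun k => qSinh q ((2 * (k + 1) : ℕ) * t) / 2) ?_ ?_ ?_ k
  · rw [this]
    rw [qSinh_natCast_mul, vertWeight, if_neg h0, qSinh]
    ring
  all_goals
    intros
    simp only [qSinh_natCast_mul, qCosh_two_mul]
    generalize q ^ t = x at *
    generalize q ^ (-t) = z at *
    have hx : x ^ 2 * z ^ 2 = 1 := by rw [← mul_pow, h, one_pow]
  · ring
  · linear_combination -(x ^ 2 - z ^ 2) / 2 * hx
  · rename_i n
    linear_combination -(x ^ (2 * (n + 2)) - z ^ (2 * (n + 2))) / 2 * hx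

/-- The parameter `d = 2` compensates for starting at `1` instead of `qCosh q 0 = 2`, as monicity
requires. -/
theorem eval_chebyshevLike_qCosh (hq : q ≠ 0) (k : ℕ) (t : ℤ) :
    (chebyshevLike 0 2 k).eval (qCosh q (2 * t)) =
      if k = 0 then 1 else qCosh q ((2 * k : ℕ) * t) := by
  have h := zpow_mul_zpow_neg hq t
  have := eval_chebyshevLike (c := (0 : K)) (d := 2) (y := qCosh q (2 * t))
    (f := fun k => if k = 0 then 1 else qCosh q ((2 * k : ℕ) * t)) ?_ ?_ ?_ k
  · rw [this]
    simp
  all_goals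
    intros
    simp only [qCosh_natCast_mul, qCosh_two_mul]
    generalize q ^ t = x at *
    generalize q ^ (-t) = z at *
    have hx : x ^ 2 * z ^ 2 = 1 := by rw [← mul_pow, h, one_pow]
    simp
  · linear_combination -2 * hx
  · rename_i n
    linear_combination -(x ^ (2 * (n + 1)) + z ^ (2 * (n + 1))) * hx

theorem gap_bounds {m : ℕ} {j a : ℤ} {s : Fin m → ℤ} (hs : StrictMono s) (ha : Odd (a + j))
    (has : ∀ i, a < s i) (hsj : ∀ i, Even (s i + j)) (i : Fin m) :
    Odd (gapStart a s i + j) ∧ gapStart a s i ≤ s i + 1 ∧ a ≤ gapStart a s i := by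
  cases m with
  | zero => exact i.elim0
  | succ m =>
    refine Fin.cases ?_ (fun i => ?_) i
    · rw [gapStart_zero]
      exact ⟨ha, by have := has 0; omega, le_rfl⟩
    · rw [gapStart_succ]
      have h1 : s i.castSucc < s i.succ := hs (Fin.castSucc_lt_succ)
      refine ⟨?_, by omega, by have := has i.castSucc; omega⟩
      rw [show s i.castSucc + 1 + j = s i.castSucc + j + 1 by ring]
      exact (hsj _).add_one

theorem strictMono_of_mem_gap {m : ℕ} {a : ℤ} {s u : Fin m → ℤ}
    (h : ∀ i, gapStart a s i ≤ u i ∧ u i < s i) : StrictMono u := by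
  cases m with
  | zero => exact fun i => i.elim0
  | succ m =>
    rw [Fin.strictMono_iff_lt_succ]
    intro i
    have h1 := (h i.castSucc).2
    have h2 := (h i.succ).1
    rw [gapStart_succ] at h2
    omega

/-- The transfer through a strip whose leftmost unit triangle is down-pointing. -/
theorem sum_gap_down (hq : q ≠ 0) (h2 : (2 : K) ≠ 0) (hδ : ∀ r : ℕ, 0 < r → qSinh q r ≠ 0)
    {m : ℕ} {j : ℤ} (hj : Odd j) (s : Fin m → ℤ) (hs : StrictMono s) (hpos : ∀ i, 0 < s i)
    (hsj : ∀ i, Even (s i + j)) :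
    ∑ u ∈ Fintype.piFinset (gap j 0 s), (∏ i, vertWeight q (u i)) *
        (Matrix.vandermonde fun i => qCosh q (2 * u i)).det =
      (∏ k ∈ range m, (2 * qSinh q (2 * k + 1 : ℕ))⁻¹) * (∏ i, qSinh q (s i)) *
        (Matrix.vandermonde fun i => qCosh q (2 * s i)).det := by
  rw [sum_piFinset_prod_mul_vandermonde (gap j 0 s) (vertWeight q) (fun u => qCosh q (2 * u))
    (fun k t => if t = 0 then 1 / 2 else qCosh q ((2 * k + 1 : ℕ) * t) / 2) (-1) 1
    fun k i t _ => vertWeight_mul_eval hq k t]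
  -- The antiderivative is cut off below zero so that the first gap, which starts at `0`, has no
  -- lower boundary term. The term at `t = 0` must then be `G k 1 - 0 = 1 / 2`: this is exactly the
  -- halved weight on the axis.
  set G : ℕ → ℤ → K := fun k t => if t < 0 then 0 else
    qSinh q ((2 * k + 1 : ℕ) * t) / (2 * qSinh q (2 * k + 1 : ℕ)) with hG
  have hj0 : Odd (0 + j) := by simpa using hj
  have hgap : ∀ (i k : Fin m), (∑ t ∈ gap j 0 s i,
      if t = 0 then (1 : K) / 2 else qCosh q ((2 * (k : ℕ) + 1 : ℕ) * t) / 2) =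
        G k (s i) - G k (gapStart 0 s i - 1) := by
    intro i k
    obtain ⟨b1, b2, b3⟩ := gap_bounds hs hj0 hpos hsj i
    refine sum_gap (G := G k) b1 (hsj i) b2 fun t ht _ hodd => ?_
    have hk := hδ (2 * (k : ℕ) + 1) (by omega)
    have ht0 : 0 ≤ t := b3.trans ht
    rcases ht0.eq_or_lt with rfl | ht0
    · simp only [hG]
      norm_num
      push_cast at hk
      field_simp
    · simp only [hG]
      rw [if_neg (by omega), if_neg (by omega), if_neg (by omega), mul_add, mul_sub, mul_one,
        ← sub_div, qSinh_add_sub_qSinh_sub hq]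
      field_simp
  have hdet : (Matrix.of fun i k : Fin m => ∑ t ∈ gap j 0 s i,
      if t = 0 then (1 : K) / 2 else qCosh q ((2 * (k : ℕ) + 1 : ℕ) * t) / 2).det =
        (Matrix.of fun i k : Fin m => G k (s i)).det := by
    simp only [hgap]
    cases m with
    | zero => simp
    | succ m =>
      refine det_telescope _ _ (fun k => ?_) (fun i k => ?_)
      · simp [gapStart_zero, hG]
      · simp [gapStart_succ]
  rw [hdet, ← det_eval_chebyshevLike 1 1, mul_assoc, ← Matrix.det_mul_column,
    ← Fin.prod_univ_eq_prod_range (fun k => (2 * qSinh q (2 * k + 1 : ℕ))⁻¹),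
    ← Matrix.det_mul_row]
  congr 1
  ext i k
  simp only [hG, Matrix.of_apply]
  rw [if_neg (hpos i).not_gt, qSinh_odd_mul hq]
  ring

/-- The transfer through a strip whose leftmost unit triangle is up-pointing. -/
theorem sum_gap_up (hq : q ≠ 0) (h2 : (2 : K) ≠ 0) (hδ : ∀ r : ℕ, 0 < r → qSinh q r ≠ 0)
    {m : ℕ} {j : ℤ} (s : Fin (m + 1) → ℤ) (hs : StrictMono s) (hpos : ∀ i, 0 ≤ s i)
    (hsj : ∀ i, Even (s i + j)) :
    ∑ t ∈ Fintype.piFinset (gap j (s 0 + 1) (Fin.tail s)), (∏ i, vertWeight q (t i)) *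
        ((∏ i, qSinh q (t i)) * (Matrix.vandermonde fun i => qCosh q (2 * t i)).det) =
      (∏ k ∈ range m, (2 * qSinh q (2 * (k + 1) : ℕ))⁻¹) *
        (Matrix.vandermonde fun i => qCosh q (2 * s i)).det := by
  have ha : Odd (s 0 + 1 + j) := by
    rw [show s 0 + 1 + j = s 0 + j + 1 by ring]; exact (hsj 0).add_one
  have hb : ∀ i, s 0 + 1 < Fin.tail s i := by
    intro i
    have h1 : s 0 < s i.succ := hs (Fin.succ_pos i)
    have h2 := hsj 0
    have h3 := hsj i.succ
    simp only [Fin.tail]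
    grind
  have hts : StrictMono (Fin.tail s) := fun i k h => hs (Fin.succ_lt_succ_iff.2 h)
  have hgb := gap_bounds hts ha hb fun i => hsj i.succ
  simp only [← mul_assoc, ← Finset.prod_mul_distrib]
  rw [sum_piFinset_prod_mul_vandermonde (gap j (s 0 + 1) (Fin.tail s))
    (fun t => vertWeight q t * qSinh q t) (fun u => qCosh q (2 * u))
    (fun k t => qSinh q ((2 * (k + 1) : ℕ) * t) / 2) 0 1 ?_]
  · set G : ℕ → Fin (m + 1) → K := fun k i =>
      qCosh q ((2 * (k + 1) : ℕ) * s i) / (2 * qSinh q (2 * (k + 1) : ℕ)) with hG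
    have hgap : ∀ (i k : Fin m), (∑ t ∈ gap j (s 0 + 1) (Fin.tail s) i,
        qSinh q ((2 * ((k : ℕ) + 1) : ℕ) * t) / 2) = G k i.succ - G k i.castSucc := by
      intro i k
      obtain ⟨b1, b2, b3⟩ := hgb i
      rw [gap, sum_gap (hi := Fin.tail s i) (G := fun t => qCosh q ((2 * ((k : ℕ) + 1) : ℕ) * t) /
        (2 * qSinh q (2 * ((k : ℕ) + 1) : ℕ))) b1 (hsj i.succ) b2 fun t ht _ hodd => ?_]
      · have : gapStart (s 0 + 1) (Fin.tail s) i - 1 = s i.castSucc := by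
          rw [← gapStart_succ' (s 0 + 1) s, gapStart_succ]
          ring
        rw [this]
        rfl
      · have hk := hδ (2 * ((k : ℕ) + 1)) (by omega)
        generalize 2 * ((k : ℕ) + 1) = r at *
        rw [mul_add, mul_sub, mul_one, ← sub_div, ← qSinh_mul_qSinh hq]
        field_simp
    simp only [hgap]
    -- The bordering column of ones is the degree-zero polynomial of the new family, which restores
    -- size `m + 1`.
    rw [det_differences, ← det_eval_chebyshevLike 0 2,
      ← Fin.prod_univ_eq_prod_range (fun k => (2 * qSinh q (2 * (k + 1) : ℕ))⁻¹)]
    have : ∏ k : Fin m, (2 * qSinh q (2 * ((k : ℕ) + 1) : ℕ))⁻¹ = ∏ k : Fin (m + 1),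
        (Fin.cons 1 (fun k : Fin m => (2 * qSinh q (2 * ((k : ℕ) + 1) : ℕ))⁻¹) :
          Fin (m + 1) → K) k := by
      rw [Fin.prod_univ_succ]
      simp
    rw [this, ← Matrix.det_mul_row]
    congr 1
    ext i k
    simp only [Matrix.of_apply, eval_chebyshevLike_qCosh hq]
    refine Fin.cases ?_ (fun k => ?_) k
    · simp
    · simp [hG]
      ring
  · intro k i t ht
    obtain ⟨b1, b2, b3⟩ := hgb i
    rw [gap, mem_filter, mem_Ico] at ht
    -- Here `t > s 0 ≥ 0`, so the exceptional weight on the axis never occurs.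
    exact vertWeight_mul_qSinh_mul_eval hq k (by have := hpos 0; omega)

end Transfer

/-! ### Evaluation of the regions above each lattice line -/

/-- The part of the trapezoid above the line of height `j`, with the up-pointing triangles resting
on this line at the abscissas `s i` removed. -/
def upperRegion (n x : ℕ) (j : ℤ) {m : ℕ} (s : Fin m → ℤ) : Finset UnitTriangle :=
  {t ∈ trapezoid n x | j ≤ t.2} \ univ.image fun i => (s i, j)

theorem mem_trapezoid {n x : ℕ} {t : UnitTriangle} :
    t ∈ trapezoid n x ↔ 0 ≤ t.1 ∧ 0 ≤ t.2 ∧ t.2 ≤ 2 * (n : ℤ) - 2 ∧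
      t.1 + t.2 ≤ 2 * ((x : ℤ) + n) - 2 := by
  simp only [trapezoid, mem_filter, mem_product, mem_Icc]
  constructor <;> intro h <;> omega

theorem mem_upperRegion {n x m : ℕ} {j : ℤ} {s : Fin m → ℤ} {t : UnitTriangle} :
    t ∈ upperRegion n x j s ↔ (t ∈ trapezoid n x ∧ j ≤ t.2) ∧ ∀ i, (s i, j) ≠ t := by
  simp [upperRegion]

theorem upperRegion_eq_union {n x m : ℕ} {j : ℤ} (hj0 : 0 ≤ j) (hj : j ≤ 2 * (n : ℤ) - 2)
    (s : Fin m → ℤ) :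
    upperRegion n x j s = rowPart j 0 (2 * ((x : ℤ) + n) - 2 - j) (univ.image s) ∪
      {t ∈ trapezoid n x | j + 1 ≤ t.2} := by
  ext ⟨i, k⟩
  simp only [mem_upperRegion, mem_union, mem_rowPart, mem_trapezoid, mem_filter, mem_image,
    mem_univ, true_and, not_exists, ne_eq, Prod.mk.injEq, not_and]
  constructor
  · rintro ⟨⟨h1, h2⟩, h3⟩
    by_cases hk : k = j
    · exact Or.inl ⟨⟨by omega, by omega, fun r hr => h3 r hr hk.symm⟩, hk⟩
    · exact Or.inr ⟨h1, by omega⟩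
  · rintro (⟨⟨h1, h2, h3⟩, rfl⟩ | h)
    · exact ⟨⟨⟨h1, hj0, hj, by omega⟩, le_rfl⟩, fun r hr => absurd hr (h3 r)⟩
    · exact ⟨⟨h.1, by omega⟩, fun r hr => by omega⟩

theorem upperRegion_eq_empty {n x : ℕ} {j : ℤ} (hj : 2 * (n : ℤ) - 2 < j) {m : ℕ}
    (s : Fin m → ℤ) : upperRegion n x j s = ∅ := by
  refine Finset.eq_empty_of_forall_notMem fun t ht => ?_
  rw [mem_upperRegion, mem_trapezoid] at ht
  omega

section Evaluation

variable {K : Type*} [Field K] {q : K}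

/-- The factor contributed by the two strips that lead from `k + 1` to `k` removed triangles. -/
def transferFactor (q : K) (k : ℕ) : K :=
  (∏ i ∈ range k, (2 * qSinh q (2 * i + 1 : ℕ))⁻¹) *
    ∏ i ∈ range k, (2 * qSinh q (2 * (i + 1) : ℕ))⁻¹

theorem tilingGF_upperRegion_odd (hq : q ≠ 0) (h2 : (2 : K) ≠ 0)
    (hδ : ∀ r : ℕ, 0 < r → qSinh q r ≠ 0) {n x k : ℕ} (hk : k + 1 ≤ n) {c : K}
    (hE : ∀ u : Fin k → ℤ, StrictMono u → (∀ i, 0 ≤ u i) →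
      (∀ i, u i + 2 * ((n : ℤ) - k) ≤ 2 * ((x : ℤ) + n) - 2) → (∀ i, Even (u i)) →
      tilingGF (wt₂ q) (upperRegion n x (2 * ((n : ℤ) - k)) u) =
        c * (Matrix.vandermonde fun i => qCosh q (2 * u i)).det)
    (s : Fin k → ℤ) (hs : StrictMono s) (hpos : ∀ i, 0 < s i)
    (hsL : ∀ i, s i + (2 * ((n : ℤ) - k) - 1) ≤ 2 * ((x : ℤ) + n) - 2) (hodd : ∀ i, Odd (s i)) :
    tilingGF (wt₂ q) (upperRegion n x (2 * ((n : ℤ) - k) - 1) s) =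
      c * (∏ i ∈ range k, (2 * qSinh q (2 * i + 1 : ℕ))⁻¹) *
        ((∏ i, qSinh q (s i)) * (Matrix.vandermonde fun i => qCosh q (2 * s i)).det) := by
  -- For `k = 0` the height `2n - 1` is above the last strip, so there is no strip to remove; `hE`
  -- for the empty sequence forces `c = 1`.
  rcases Nat.eq_zero_or_pos k with rfl | hk0
  · have := hE Fin.elim0 (fun i => i.elim0) (fun i => i.elim0) (fun i => i.elim0)
      (fun i => i.elim0)
    rw [upperRegion_eq_empty (by push_cast; omega), tilingGF_empty] at this
    rw [upperRegion_eq_empty (by push_cast; omega), tilingGF_empty, this]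
    simp
  have hj : Odd (2 * ((n : ℤ) - k) - 1) := ⟨(n : ℤ) - k - 1, by ring⟩
  rw [upperRegion_eq_union (by omega) (by omega),
    tilingGF_strip_down q s hs (by simp [hj]) ?_ (by omega) hpos
      (fun i => by have := hsL i; omega) (fun i => (hodd i).add_odd hj) (fun d _ _ => by simp)
      (fun t ht => by rw [mem_filter] at ht; omega)
      (fun t i h1 h2 h3 => ?_)]
  · rw [mul_assoc, ← mul_assoc (∏ i ∈ range k, _), ← sum_gap_down hq h2 hδ hj s hs hpos
      (fun i => (hodd i).add_odd hj), Finset.mul_sum]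
    refine Finset.sum_congr rfl fun u hu => ?_
    rw [Fintype.mem_piFinset] at hu
    have hu' : ∀ i, (gapStart 0 s i ≤ u i ∧ u i < s i) ∧ Odd (u i + (2 * ((n : ℤ) - k) - 1)) := by
      intro i
      simpa [gap] using hu i
    have hb := fun i => gap_bounds hs (a := 0) (by simp [hj]) hpos
      (fun i => (hodd i).add_odd hj) i
    have := hE u ?_ ?_ ?_ ?_
    · rw [← mul_left_comm, ← this]
      congr 2
      rw [upperRegion]
      simp only [sub_add_cancel]
    · exact strictMono_of_mem_gap fun i => (hu' i).1
    · exact fun i => by have := hb i; have := hu' i; omega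
    · exact fun i => by have := hsL i; have := hu' i; omega
    · exact fun i => by simpa using (hu' i).2.sub_odd hj
  · exact ⟨(x : ℤ) + n - 1, by ring⟩
  · rw [mem_filter, mem_trapezoid]
    have := hsL i
    simp only
    omega

theorem tilingGF_upperRegion_even_succ (hq : q ≠ 0) (h2 : (2 : K) ≠ 0)
    (hδ : ∀ r : ℕ, 0 < r → qSinh q r ≠ 0) {n x k : ℕ} (hk : k + 1 ≤ n) {c : K}
    (hO : ∀ t : Fin k → ℤ, StrictMono t → (∀ i, 0 < t i) →
      (∀ i, t i + (2 * ((n : ℤ) - k) - 1) ≤ 2 * ((x : ℤ) + n) - 2) → (∀ i, Odd (t i)) →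
      tilingGF (wt₂ q) (upperRegion n x (2 * ((n : ℤ) - k) - 1) t) =
        c * ((∏ i, qSinh q (t i)) * (Matrix.vandermonde fun i => qCosh q (2 * t i)).det))
    (s : Fin (k + 1) → ℤ) (hs : StrictMono s) (hpos : ∀ i, 0 ≤ s i)
    (hsL : ∀ i, s i + (2 * ((n : ℤ) - (k + 1 : ℕ))) ≤ 2 * ((x : ℤ) + n) - 2)
    (heven : ∀ i, Even (s i)) :
    tilingGF (wt₂ q) (upperRegion n x (2 * ((n : ℤ) - (k + 1 : ℕ))) s) =
      c * (∏ i ∈ range k, (2 * qSinh q (2 * (i + 1) : ℕ))⁻¹) *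
        (Matrix.vandermonde fun i => qCosh q (2 * s i)).det := by
  have hj : Even (2 * ((n : ℤ) - (k + 1 : ℕ))) := even_two_mul _
  have hjk : 2 * ((n : ℤ) - (k + 1 : ℕ)) + 1 = 2 * ((n : ℤ) - k) - 1 := by push_cast; ring
  have hsj := fun i => (heven i).add hj
  rw [upperRegion_eq_union (by push_cast; omega) (by push_cast; omega),
    tilingGF_strip_up q s hs (by simp) ?_ hpos
      (fun i => by have := hsL i; omega) hsj (fun d _ _ => by simp)
      (fun t ht => by rw [mem_filter] at ht; omega)
      (fun t i h1 h2 h3 => ?_)]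
  · rw [mul_assoc, ← sum_gap_up hq h2 hδ s hs hpos hsj, Finset.mul_sum]
    refine Finset.sum_congr rfl fun t ht => ?_
    rw [Fintype.mem_piFinset] at ht
    have ht' : ∀ i, (gapStart (s 0 + 1) (Fin.tail s) i ≤ t i ∧ t i < Fin.tail s i) ∧
        Odd (t i + (2 * ((n : ℤ) - (k + 1 : ℕ)))) := by
      intro i
      have := ht i
      rwa [gap, mem_filter, mem_Ico] at this
    have hst : ∀ i : Fin k, s i.castSucc < t i := by
      intro i
      have := (ht' i).1.1
      rw [← gapStart_succ' (s 0 + 1) s, gapStart_succ] at this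
      omega
    have := hO t ?_ ?_ ?_ ?_
    · rw [← mul_left_comm, ← this]
      congr 2
      rw [upperRegion]
      simp only [hjk]
    · exact strictMono_of_mem_gap fun i => (ht' i).1
    · exact fun i => by have := hst i; have := hpos i.castSucc; omega
    · intro i
      have := hsL i.succ
      have := (ht' i).1.2
      simp only [Fin.tail] at this
      push_cast at *
      omega
    · exact fun i => by simpa using (ht' i).2.sub_even hj
  · exact ⟨(x : ℤ) + n - 1, by ring⟩
  · rw [mem_filter, mem_trapezoid]
    have := hsL i.succ
    -- The index `i` forces `k ≥ 1`, which keeps the next strip inside the trapezoid.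
    have := i.isLt
    push_cast at *
    omega

/-- Induction downwards from the empty region at the top: descending two strips adds one hole, and
`k = n` is the base. -/
theorem tilingGF_upperRegion_even (hq : q ≠ 0) (h2 : (2 : K) ≠ 0)
    (hδ : ∀ r : ℕ, 0 < r → qSinh q r ≠ 0) {n x k : ℕ} (hk : k ≤ n)
    (s : Fin k → ℤ) (hs : StrictMono s) (hpos : ∀ i, 0 ≤ s i)
    (hsL : ∀ i, s i + 2 * ((n : ℤ) - k) ≤ 2 * ((x : ℤ) + n) - 2) (heven : ∀ i, Even (s i)) :
    tilingGF (wt₂ q) (upperRegion n x (2 * ((n : ℤ) - k)) s) =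
      (∏ i ∈ range k, transferFactor q i) *
        (Matrix.vandermonde fun i => qCosh q (2 * s i)).det := by
  induction k with
  | zero =>
    rw [upperRegion_eq_empty (by push_cast; omega), tilingGF_empty]
    simp
  | succ k ih =>
    rw [tilingGF_upperRegion_even_succ hq h2 hδ hk
      (tilingGF_upperRegion_odd hq h2 hδ hk (ih (by omega))) s hs hpos hsL heven,
      prod_range_succ, transferFactor, mul_assoc (∏ i ∈ range k, transferFactor q i)]

end Evaluation

/-! ### Conversion to `q`-integers -/

section ProductFormula

variable {K : Type*} [Field K] {q : K}

theorem qInt_sq_mul_qSinh (hq : q ≠ 0) (m : ℕ) :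
    qInt (q ^ 2) m * qSinh q 1 = q ^ ((m : ℤ) - 1) * qSinh q m := by
  have h : qInt (q ^ 2) m * (q ^ 2 - 1) = (q ^ 2) ^ m - 1 := geom_sum_mul _ _
  rw [qSinh, qSinh, zpow_sub₀ hq, zpow_neg, zpow_neg, zpow_natCast, zpow_one]
  have := pow_ne_zero m hq
  field_simp
  linear_combination h

/-- Product-to-sum for `qSinh`: two `q`-integers combine into one Vandermonde factor, with `2a - 2`
and `2b - 2` the abscissas of base positions `a` and `b`. -/
theorem qInt_mul_qInt (hq : q ≠ 0) (h1 : qSinh q 1 ≠ 0) {a b : ℕ} (ha : 1 ≤ a) (hab : a ≤ b) :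
    qInt (q ^ 2) (2 * (a + b - 2)) * qInt (q ^ 2) (2 * (b - a)) =
      q ^ (4 * (b : ℤ) - 6) * (qSinh q 1 ^ 2)⁻¹ *
        (qCosh q (2 * (2 * b - 2)) - qCosh q (2 * (2 * a - 2))) := by
  have e1 := qInt_sq_mul_qSinh hq (2 * (a + b - 2))
  have e2 := qInt_sq_mul_qSinh hq (2 * (b - a))
  have c1 : ((2 * (a + b - 2) : ℕ) : ℤ) = 2 * ((a : ℤ) + b - 2) := by
    rw [Nat.cast_mul, Nat.cast_sub (by omega)]; push_cast; ring
  have c2 : ((2 * (b - a) : ℕ) : ℤ) = 2 * ((b : ℤ) - a) := by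
    rw [Nat.cast_mul, Nat.cast_sub hab]; push_cast; ring
  rw [c1] at e1
  rw [c2] at e2
  have e3 := qSinh_mul_qSinh hq (2 * ((a : ℤ) + b - 2)) (2 * ((b : ℤ) - a))
  rw [show 2 * ((a : ℤ) + b - 2) + 2 * ((b : ℤ) - a) = 2 * (2 * b - 2) by ring,
    show 2 * ((a : ℤ) + b - 2) - 2 * ((b : ℤ) - a) = 2 * (2 * a - 2) by ring] at e3
  rw [← e3, show 4 * (b : ℤ) - 6 = (2 * ((a : ℤ) + b - 2) - 1) + (2 * ((b : ℤ) - a) - 1) by ring,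
    zpow_add₀ hq]
  field_simp
  linear_combination (qInt (q ^ 2) (2 * (b - a)) * qSinh q 1) * e1 +
    q ^ (2 * ((a : ℤ) + b - 2) - 1) * qSinh q (2 * ((a : ℤ) + b - 2)) * e2

theorem qFactorial_succ (p : K) (m : ℕ) :
    qFactorial p (m + 1) = qFactorial p m * qInt p (m + 1) := by
  rw [qFactorial, Finset.prod_Icc_succ_top (by omega), qFactorial]

/-- The transfer factor is the product of `(2 * qSinh q r)⁻¹` over `1 ≤ r ≤ 2k`, so it cancels the
`q`-factorial up to powers; the exponent of `q` is the sum of the `r - 1`. -/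
theorem qFactorial_mul_transferFactor (hq : q ≠ 0) (h2 : (2 : K) ≠ 0)
    (hδ : ∀ r : ℕ, 0 < r → qSinh q r ≠ 0) (k : ℕ) :
    qFactorial (q ^ 2) (2 * k) * transferFactor q k =
      2 ^ (-(2 * k : ℤ)) * q ^ ((k : ℤ) * (2 * k - 1)) * ((qSinh q 1 ^ 2)⁻¹) ^ k := by
  have h1 : qSinh q 1 ≠ 0 := by simpa using hδ 1 one_pos
  induction k with
  | zero => simp [qFactorial, transferFactor]
  | succ k ih =>
    have d1 := hδ (2 * k + 1) (by omega)
    have d2 := hδ (2 * k + 2) (by omega)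
    have e1 := qInt_sq_mul_qSinh hq (2 * k + 1)
    have e2 := qInt_sq_mul_qSinh hq (2 * k + 2)
    have ht : transferFactor q (k + 1) = transferFactor q k *
        ((2 * qSinh q (2 * k + 1 : ℕ))⁻¹ * (2 * qSinh q (2 * k + 2 : ℕ))⁻¹) := by
      simp only [transferFactor, prod_range_succ, mul_add, mul_one]
      ring
    have hf : qFactorial (q ^ 2) (2 * (k + 1)) = qFactorial (q ^ 2) (2 * k) *
        (qInt (q ^ 2) (2 * k + 1) * qInt (q ^ 2) (2 * k + 2)) := by
      rw [show 2 * (k + 1) = 2 * k + 1 + 1 by ring, qFactorial_succ, qFactorial_succ]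
      ring
    rw [← eq_div_iff h1] at e1 e2
    rw [ht, hf, e1, e2, mul_mul_mul_comm, ih, pow_succ _ k]
    have z1 : (2 : K) ^ (-(2 * ((k + 1 : ℕ) : ℤ))) = 2 ^ (-(2 * k : ℤ)) * (2 ^ 2)⁻¹ := by
      rw [show -(2 * ((k + 1 : ℕ) : ℤ)) = -(2 * k : ℤ) + -2 by push_cast; ring, zpow_add₀ h2,
        zpow_neg _ 2, zpow_ofNat]
    have z2 : q ^ (((k + 1 : ℕ) : ℤ) * (2 * ((k + 1 : ℕ) : ℤ) - 1)) =
        q ^ ((k : ℤ) * (2 * k - 1)) *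
          (q ^ (((2 * k + 1 : ℕ) : ℤ) - 1) * q ^ (((2 * k + 2 : ℕ) : ℤ) - 1)) := by
      rw [← zpow_add₀ hq, ← zpow_add₀ hq]
      congr 1
      push_cast
      ring
    rw [z1, z2]
    generalize ((qSinh q 1 ^ 2)⁻¹) ^ k = A
    field_simp

/-- With `j = k + 1`, the values `i + j - 1` fill `k + 1, …, 2k` and the values `j - i` fill `1, …,
k`. This links the two forms of the denominator. -/
theorem qFactorial_two_mul (p : K) (k : ℕ) :
    qFactorial p (2 * k) =
      ∏ i ∈ Ico 1 (k + 1), (qInt p (i + (k + 1) - 1) * qInt p (k + 1 - i)) := by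
  rw [Finset.prod_mul_distrib, Finset.prod_Ico_reflect (fun i => qInt p i) 1 (by omega), qFactorial,
    ← Finset.Ico_add_one_right_eq_Icc,
    ← Finset.prod_Ico_consecutive _ (show 1 ≤ k + 1 by omega) (show k + 1 ≤ 2 * k + 1 by omega),
    mul_comm]
  congr 1
  · rw [Finset.prod_Ico_eq_prod_range, Finset.prod_Ico_eq_prod_range]
    refine Finset.prod_congr (by congr 1; omega) fun i _ => ?_
    congr 1
    omega
  · simp

theorem qFactorial_ne_zero (hq : q ≠ 0) (hδ : ∀ r : ℕ, 0 < r → qSinh q r ≠ 0) (m : ℕ) :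
    qFactorial (q ^ 2) m ≠ 0 := by
  rw [qFactorial, Finset.prod_ne_zero_iff]
  intro r hr h
  rw [mem_Icc] at hr
  have := qInt_sq_mul_qSinh hq r
  rw [h, zero_mul] at this
  exact mul_ne_zero (zpow_ne_zero _ hq) (hδ r (by omega)) this.symm

/-- The contribution of the largest index to the product formula; the powers of `qSinh q 1` on the
two sides agree. -/
theorem transferFactor_mul_prod (hq : q ≠ 0) (h2 : (2 : K) ≠ 0)
    (hδ : ∀ r : ℕ, 0 < r → qSinh q r ≠ 0) (k : ℕ) (s : ℕ → ℕ)
    (hs : ∀ i ∈ Ico 1 (k + 1), 1 ≤ s i ∧ s i ≤ s (k + 1)) :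
    transferFactor q k * ∏ i ∈ Ico 1 (k + 1),
        (qCosh q (2 * (2 * s (k + 1) - 2)) - qCosh q (2 * (2 * s i - 2))) =
      2 ^ (-(2 * k : ℤ)) *
        q ^ (-((4 * ((k + 1 : ℕ) : ℤ) - 4) * (s (k + 1) : ℤ) - 2 * ((k + 1 : ℕ) : ℤ) ^ 2 -
          ((k + 1 : ℕ) : ℤ) + 3)) *
        ((∏ i ∈ Ico 1 (k + 1), qInt (q ^ 2) (2 * (s i + s (k + 1) - 2)) *
          qInt (q ^ 2) (2 * (s (k + 1) - s i))) / qFactorial (q ^ 2) (2 * (k + 1) - 2)) := by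
  have h1 : qSinh q 1 ≠ 0 := by simpa using hδ 1 one_pos
  have hF := qFactorial_ne_zero hq hδ (2 * k)
  have hT := qFactorial_mul_transferFactor hq h2 hδ k
  rw [mul_comm, ← eq_div_iff hF] at hT
  rw [Finset.prod_congr rfl fun i hi => qInt_mul_qInt hq h1 (hs i hi).1 (hs i hi).2,
    Finset.prod_mul_distrib, Finset.prod_const, Nat.card_Ico, Nat.add_sub_cancel, mul_pow, hT,
    show 2 * (k + 1) - 2 = 2 * k by omega, ← zpow_natCast (q ^ (4 * (s (k + 1) : ℤ) - 6)),
    ← zpow_mul]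
  have : q ^ ((k : ℤ) * (2 * k - 1)) =
      q ^ (-((4 * ((k + 1 : ℕ) : ℤ) - 4) * (s (k + 1) : ℤ) - 2 * ((k + 1 : ℕ) : ℤ) ^ 2 -
          ((k + 1 : ℕ) : ℤ) + 3)) * q ^ ((4 * (s (k + 1) : ℤ) - 6) * k) := by
    rw [← zpow_add₀ hq]
    congr 1
    push_cast
    ring
  rw [this]
  ring

theorem det_vandermonde_eq_prod_Icc (y : ℕ → K) (n : ℕ) :
    (Matrix.vandermonde fun i : Fin n => y (i + 1)).det =
      ∏ j ∈ Icc 1 n, ∏ i ∈ Ico 1 j, (y j - y i) := by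
  rw [Matrix.det_vandermonde]
  rw [Finset.prod_comm' (t' := univ) (s' := fun j => Iio j) (by simp)]
  have h : ∀ j : Fin n, ∏ i ∈ Iio j, (y (j + 1) - y (i + 1)) =
      ∏ i ∈ Ico 1 ((j : ℕ) + 1), (y (j + 1) - y i) := by
    intro j
    rw [Finset.prod_Ico_eq_prod_range, Nat.add_sub_cancel, ← Nat.Iio_eq_range,
      ← Fin.map_valEmbedding_Iio, Finset.prod_map]
    simp [add_comm]
  simp only [h]
  rw [Fin.prod_univ_eq_prod_range (fun j => ∏ i ∈ Ico 1 (j + 1), (y (j + 1) - y i)),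
    ← Finset.Ico_add_one_right_eq_Icc, Finset.prod_Ico_eq_prod_range, Nat.add_sub_cancel]
  simp [add_comm]

theorem prod_transferFactor_mul_det (hq : q ≠ 0) (h2 : (2 : K) ≠ 0)
    (hδ : ∀ r : ℕ, 0 < r → qSinh q r ≠ 0) (n : ℕ) (s : ℕ → ℕ)
    (hs : ∀ i ∈ Set.Icc 1 n, 1 ≤ s i) (hmono : StrictMonoOn s (Set.Icc 1 n)) :
    (∏ k ∈ range n, transferFactor q k) *
        ∏ j ∈ Icc 1 n, ∏ i ∈ Ico 1 j,
          (qCosh q (2 * (2 * s j - 2)) - qCosh q (2 * (2 * s i - 2))) =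
      (2 : K) ^ (-((n : ℤ) * ((n : ℤ) - 1))) *
        q ^ (-∑ i ∈ Icc 1 n,
          ((4 * (i : ℤ) - 4) * (s i : ℤ) - 2 * (i : ℤ) ^ 2 - (i : ℤ) + 3)) *
        ((∏ j ∈ Icc 1 n, ∏ i ∈ Ico 1 j,
            qInt (q ^ 2) (2 * (s i + s j - 2)) * qInt (q ^ 2) (2 * (s j - s i))) /
          ∏ i ∈ Icc 1 n, qFactorial (q ^ 2) (2 * i - 2)) := by
  induction n with
  | zero => simp
  | succ n ih =>
    have hsub : Set.Icc 1 n ⊆ Set.Icc 1 (n + 1) := Set.Icc_subset_Icc_right (by omega)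
    have ih := ih (fun i hi => hs i (hsub hi)) (hmono.mono hsub)
    have step := transferFactor_mul_prod hq h2 hδ n s fun i hi => by
      rw [mem_Ico] at hi
      refine ⟨hs i ⟨hi.1, by omega⟩, (hmono ⟨hi.1, by omega⟩ ⟨by omega, le_rfl⟩ hi.2).le⟩
    rw [prod_range_succ, Finset.prod_Icc_succ_top (by omega), mul_mul_mul_comm, ih, step,
      Finset.prod_Icc_succ_top (by omega), Finset.prod_Icc_succ_top (by omega),
      Finset.sum_Icc_succ_top (by omega), neg_add (∑ i ∈ Icc 1 n, _),
      zpow_add₀ hq,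
      show -(((n + 1 : ℕ) : ℤ) * (((n + 1 : ℕ) : ℤ) - 1)) = -((n : ℤ) * (n - 1)) + -(2 * n : ℤ) by
        push_cast; ring, zpow_add₀ h2]
    ring

theorem prod_div_prod_qFactorial (p : K) (n : ℕ) (s : ℕ → ℕ) :
    (∏ j ∈ Icc 1 n, ∏ i ∈ Ico 1 j, qInt p (2 * (s i + s j - 2)) * qInt p (2 * (s j - s i))) /
        ∏ i ∈ Icc 1 n, qFactorial p (2 * i - 2) =
      (∏ j ∈ Icc 1 n, ∏ i ∈ Ico 1 j, qInt p (2 * (s i + s j - 2)) / qInt p (i + j - 1)) *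
        ∏ j ∈ Icc 1 n, ∏ i ∈ Ico 1 j, qInt p (2 * (s j - s i)) / qInt p (j - i) := by
  rw [← Finset.prod_div_distrib, ← Finset.prod_mul_distrib]
  refine Finset.prod_congr rfl fun j hj => ?_
  obtain ⟨k, rfl⟩ : ∃ k, j = k + 1 := ⟨j - 1, by rw [mem_Icc] at hj; omega⟩
  rw [show 2 * (k + 1) - 2 = 2 * k by omega, qFactorial_two_mul, ← Finset.prod_div_distrib,
    ← Finset.prod_mul_distrib]
  exact Finset.prod_congr rfl fun i _ => (div_mul_div_comm _ _ _ _).symm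

end ProductFormula

/-! ### Specialization to the quartered hexagon over `ℚ(q)` -/

theorem quarteredHexagon_eq_upperRegion (n x : ℕ) (s : ℕ → ℕ) :
    quarteredHexagon n x s = upperRegion n x 0 fun i : Fin n => 2 * (s (i + 1) : ℤ) - 2 := by
  ext t
  simp only [quarteredHexagon, mem_upperRegion, mem_sdiff, mem_image, mem_Icc, baseTriangle,
    not_exists, not_and]
  constructor
  · rintro ⟨h1, h2⟩
    exact ⟨⟨h1, (mem_trapezoid.1 h1).2.1⟩, fun i => h2 (i + 1) ⟨by omega, by omega⟩⟩
  · rintro ⟨⟨h1, -⟩, h2⟩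
    refine ⟨h1, fun i hi => ?_⟩
    have := h2 ⟨i - 1, by omega⟩
    rwa [show ((⟨i - 1, by omega⟩ : Fin n) : ℕ) + 1 = i from Nat.sub_add_cancel hi.1] at this

/-- Vanishing would give `X ^ (2r) = 1`, which is impossible by degree; hence no denominator of the
transfer vanishes. -/
theorem qSinh_ratFunc_X_ne_zero (r : ℕ) (hr : 0 < r) :
    qSinh (RatFunc.X : RatFunc ℚ) r ≠ 0 := by
  have hX : (RatFunc.X : RatFunc ℚ) ≠ 0 := RatFunc.X_ne_zero
  intro h
  rw [qSinh, sub_eq_zero, zpow_neg, zpow_natCast,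
    ← mul_eq_one_iff_eq_inv₀ (pow_ne_zero _ hX), ← pow_add] at h
  rw [← RatFunc.algebraMap_X, ← map_pow, ← map_one (algebraMap (Polynomial ℚ) (RatFunc ℚ))] at h
  have h' := congrArg Polynomial.natDegree (RatFunc.algebraMap_injective ℚ h)
  rw [Polynomial.natDegree_X_pow, Polynomial.natDegree_one] at h'
  omega

end QuarteredHexagon
end

theorem mainTheorem5 (n x : ℕ) (s : ℕ → ℕ)
    (hs : ∀ i ∈ Set.Icc 1 n, 1 ≤ s i ∧ s i ≤ n + x)
    (hmono : StrictMonoOn s (Set.Icc 1 n))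
    (q : RatFunc ℚ) (hq : q = RatFunc.X) :
    QuarteredHexagon.tilingGFR3 q n x s =
        (2 : RatFunc ℚ) ^ (-((n : ℤ) * ((n : ℤ) - 1))) *
          q ^ (-∑ i ∈ Finset.Icc 1 n,
            ((4 * (i : ℤ) - 4) * (s i : ℤ) - 2 * (i : ℤ) ^ 2 - (i : ℤ) + 3)) *
          ((∏ j ∈ Finset.Icc 1 n, ∏ i ∈ Finset.Ico 1 j,
              QuarteredHexagon.qInt (q ^ 2) (2 * (s i + s j - 2)) *
                QuarteredHexagon.qInt (q ^ 2) (2 * (s j - s i))) /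
            ∏ i ∈ Finset.Icc 1 n, QuarteredHexagon.qFactorial (q ^ 2) (2 * i - 2)) ∧
      QuarteredHexagon.tilingGFR3 q n x s =
        (2 : RatFunc ℚ) ^ (-((n : ℤ) * ((n : ℤ) - 1))) *
          q ^ (-∑ i ∈ Finset.Icc 1 n,
            ((4 * (i : ℤ) - 4) * (s i : ℤ) - 2 * (i : ℤ) ^ 2 - (i : ℤ) + 3)) *
          (∏ j ∈ Finset.Icc 1 n, ∏ i ∈ Finset.Ico 1 j,
            QuarteredHexagon.qInt (q ^ 2) (2 * (s i + s j - 2)) /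
              QuarteredHexagon.qInt (q ^ 2) (i + j - 1)) *
          (∏ j ∈ Finset.Icc 1 n, ∏ i ∈ Finset.Ico 1 j,
            QuarteredHexagon.qInt (q ^ 2) (2 * (s j - s i)) /
              QuarteredHexagon.qInt (q ^ 2) (j - i)) := by
  have hq0 : q ≠ 0 := hq ▸ RatFunc.X_ne_zero
  have h2 : (2 : RatFunc ℚ) ≠ 0 := two_ne_zero
  have hδ : ∀ r : ℕ, 0 < r → QuarteredHexagon.qSinh q r ≠ 0 :=
    hq ▸ QuarteredHexagon.qSinh_ratFunc_X_ne_zero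
  have key := QuarteredHexagon.tilingGF_upperRegion_even (x := x) hq0 h2 hδ (le_refl n)
    (fun i => 2 * (s (i + 1) : ℤ) - 2)
    (fun i k h => by
      have : s (i + 1) < s (k + 1) := hmono ⟨by omega, by omega⟩ ⟨by omega, by omega⟩
        (Nat.succ_lt_succ h)
      simp only
      omega)
    (fun i => by have := (hs (i + 1) ⟨by omega, by omega⟩).1; omega)
    (fun i => by have := (hs (i + 1) ⟨by omega, by omega⟩).2; omega)
    (fun i => ⟨(s (i + 1) : ℤ) - 1, by ring⟩)
  -- With `k = n` the line has height `2 * (n - n) = 0`, the base itself.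
  rw [sub_self, mul_zero, ← QuarteredHexagon.quarteredHexagon_eq_upperRegion,
    QuarteredHexagon.det_vandermonde_eq_prod_Icc
      (fun i => QuarteredHexagon.qCosh q (2 * (2 * (s i : ℤ) - 2))),
    QuarteredHexagon.prod_transferFactor_mul_det hq0 h2 hδ n s (fun i hi => (hs i hi).1) hmono]
    at key
  refine ⟨key, ?_⟩
  rw [mul_assoc _ (∏ j ∈ Finset.Icc 1 n, _), ← QuarteredHexagon.prod_div_prod_qFactorial]
  exact key
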